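/- Let $\xi_1,\xi_2,\dots\ge 0$ (claim sizes) and $\tau_1,\tau_2,\dots\ge0$ (inter-claim times) be two independent i.i.d. sequences, with generic copies $\xi$ and $\tau$, and $\mathbb E\tau>0$. Put $T_n=\tau_1+\dots+\tau_n$, $T_0=0$, and $N(t)=\max\{n\ge 0: T_n\le t\}$. Let $v:\mathbb R\to[0,\infty)$ be measurable and bounded. For every $x>0$ let $R_x$ be a risk reserve process with premium rate $v$ and initial reserve $x$, that is, almost surely $$R_x(t)=x+\int_0^t v(R_x(s))\,ds-\sum_{j=1}^{N(t)}\xi_j\qquad\text{for all }t\ge 0,$$ and let $\psi(x)=\mathbb P\{R_x(t)<0\text{ for some }t\ge0\}$ be its ruin probability. Put $v_c=\mathbb E\xi/\mathbb E\tau$, and assume that for some real $\theta$ $$\Bigl|v(z)-v_c-\frac{\theta}{z}\Bigr|\le p(z)\quad\text{for all }z>1,\qquad \theta>\frac{\operatorname{Var}\xi+v_c^2\operatorname{Var}\tau}{2\,\mathbb E\tau},$$ where $p>0$ is a decreasing function that is integrable at infinity. Put $$\rho=\frac{2\theta\,\mathbb E\tau}{\operatorname{Var}\xi+v_c^2\operatorname{Var}\tau}-1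 .$$ Assume also that $\mathbb E\,\tau^2\log(1+\tau)<\infty$ and that $\mathbb P\{\xi>x\}=x^{-2-\beta}L(x)$ for all $x>0$, where $\beta\in(0,\rho)$ and $L$ is slowly varying at infinity. Then $\int_0^\infty y\,\mathbb P\{\xi>y\}\,dy<\infty$, and there exist constants $C_1,C_2>0$ such that $$C_1\int_x^\infty y\,\mathbb P\{\xi>y\}\,dy\le\psi(x)\le C_2\int_x^\infty y\,\mathbb P\{\xi>y\}\,dy\qquad\text{for all }x>0 .$$ Moreover, for every $x_0>0$ there exist constants $\widehat C_1,\widehat C_2>0$ such that $$\widehat C_1\,x^2\,\mathbb P\{\xi>x\}\le\psi(x)\le\widehat C_2\,x^2\,\mathbb P\{\xi>x\}\qquad\text{for all }x\ge x_0 .$$ -/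

import Mathlib

open MeasureTheory ProbabilityTheory Filter Topology

/-- The `n`-th claim epoch `T_n = τ_1 + ⋯ + τ_n` (with `T_0 = 0`); the inter-claim times are indexed
from `0`, so that `τ n` is the time between the `n`-th and the `(n+1)`-st claim. -/
noncomputable def claimEpoch {Ω : Type*} (τ : ℕ → Ω → ℝ) (n : ℕ) (ω : Ω) : ℝ :=
  ∑ i ∈ Finset.range n, τ i ω

/-- The number of claims up to time `t`, that is `N(t) = max {n : T_n ≤ t}`. (When the inter-claim
times are i.i.d., nonnegative and of positive mean, this set is almost surely finite for all `t`.) -/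
noncomputable def claimCount {Ω : Type*} (τ : ℕ → Ω → ℝ) (t : ℝ) (ω : Ω) : ℕ :=
  sSup {n : ℕ | claimEpoch τ n ω ≤ t}

/-- `R` is a risk reserve process with level-dependent premium rate `v`, inter-claim times `τ`,
claim sizes `ξ` and initial reserve `x`: almost surely, for all `t ≥ 0`,
`R(t) = x + ∫_0^t v(R(s)) ds - ∑_{j ≤ N(t)} ξ_j`. -/
def IsRiskReserve {Ω : Type*} [MeasurableSpace Ω] (μ : Measure Ω) (v : ℝ → ℝ)
    (τ ξ : ℕ → Ω → ℝ) (x : ℝ) (R : ℝ → Ω → ℝ) : Prop :=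
  ∀ᵐ ω ∂μ, ∀ t : ℝ, 0 ≤ t →
    IntervalIntegrable (fun s => v (R s ω)) volume 0 t ∧
    R t ω = x + (∫ s in (0 : ℝ)..t, v (R s ω)) - ∑ j ∈ Finset.range (claimCount τ t ω), ξ j ω

/-- The probability of ruin `P{R(t) < 0 for some t ≥ 0}`. -/
noncomputable def ruinProb {Ω : Type*} [MeasurableSpace Ω] (μ : Measure Ω) (R : ℝ → Ω → ℝ) : ℝ :=
  μ.real {ω | ∃ t : ℝ, 0 ≤ t ∧ R t ω < 0}

/-- The critical premium rate `v_c = E ξ / E τ`. -/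
noncomputable def criticalRate {Ω : Type*} [MeasurableSpace Ω] (μ : Measure Ω) (τ ξ : Ω → ℝ) : ℝ :=
  (∫ ω, ξ ω ∂μ) / (∫ ω, τ ω ∂μ)

/-- The quantity `Var ξ + v_c² Var τ`. -/
noncomputable def limitVariance {Ω : Type*} [MeasurableSpace Ω] (μ : Measure Ω) (τ ξ : Ω → ℝ) : ℝ :=
  variance ξ μ + criticalRate μ τ ξ ^ 2 * variance τ μ

/-- The exponent `ρ = 2 θ E τ / (Var ξ + v_c² Var τ) - 1`. -/
noncomputable def ruinExponent {Ω : Type*} [MeasurableSpace Ω] (μ : Measure Ω) (τ ξ : Ω → ℝ)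
    (θ : ℝ) : ℝ :=
  2 * θ * (∫ ω, τ ω ∂μ) / limitVariance μ τ ξ - 1

/-- The function `v` approaches `c` at infinity at rate `θ / z`: one has `|v(z) - c - θ/z| ≤ p(z)`
for all `z > 1`, for some positive decreasing function `p` that is integrable at infinity. -/
def ApproachesAtRate (v : ℝ → ℝ) (c θ : ℝ) : Prop :=
  ∃ p : ℝ → ℝ, (∀ z, 1 < z → 0 < p z) ∧ AntitoneOn p (Set.Ioi 1) ∧
    IntegrableAtFilter p atTop volume ∧ ∀ z, 1 < z → |v z - c - θ / z| ≤ p z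

/-- A function that is slowly varying at infinity. -/
def SlowlyVarying (L : ℝ → ℝ) : Prop :=
  Measurable L ∧ (∀ᶠ x in atTop, 0 < L x) ∧
    ∀ c : ℝ, 0 < c → Tendsto (fun x => L (c * x) / L x) atTop (𝓝 1)

/-! Ruin is decided by the reserve after each claim. At a high level `y` this chain has steps of the
form `v_c τ - ξ + θ τ / y`: a centred part of variance `σ² = Var ξ + v_c² Var τ` plus a drift of
order `θ E τ / y`. A power `x ^ (-b)` is superharmonic for small steps when `(b + 1) σ² / 2 < θ E
τ`, that is `b < ρ`. Since `β < ρ`, diffusive ruin is rarer than ruin by a single large claim, which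
can come during about `x²` claims, each with probability of order `F(x) = P(ξ > x)`. Hence the order
`x² F(x)`.

Upper bound. `x² F(x)` cannot serve as a Lyapunov function directly, because the slowly varying
factor need not be smooth. Fix `b` in `(β, ρ)` and mix the smooth kernels `|s| ^ (2 + b) (x² + s²) ^
(-b/2)` over the law of `ξ`; the mixture `V` (`lyapunov`) is `O(x² F(x))` by `lyapunov_le`. Each
kernel decreases on average under moderate steps, and the kernels with `s > y` together gain at
least a constant times `F(y)`. A claim above `δ y` costs at most `V(x₁) P(ξ > δ y)`, and `V(x₁)` is
small for large `x₁`, so the gain pays for it (`lyapunov_step_le`). A chain bounding the reserve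
from below (`compChain_le_postClaim`) then falls to `x₁` with probability at most `V(x) / V(x₁)`
(`measure_compChain_le`).

Lower bound. Second moments (`stoppedWalk_second_moment`) show that, for each of the first `ε x²`
claims, the reserve has stayed of order `x` with probability at least `1/2`. A next claim above `K
x` is independent of this past and causes ruin (`ReservePath.postClaim_neg`). The corresponding
events are disjoint, so their probabilities add to at least a multiple of `x² F(x)` (`ruinProb_ge`).

Dyadic summation makes `x² F(x)` comparable with the integrated tail. On bounded ranges of `x` the
first claim alone keeps the ruin probability away from zero. -/

/-! ### Taylor bounds for the kernels -/

/-- Second-order Taylor upper bound for `q ↦ (1 + q) ^ (-a)` near `0`. -/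
theorem one_add_rpow_neg_le {a ε : ℝ} (hε : 0 < ε) :
    ∃ η : ℝ, 0 < η ∧ η < 1 ∧ ∀ q : ℝ, |q| ≤ η →
      (1 + q) ^ (-a) ≤ 1 - a * q + (a * (a + 1) / 2 + ε) * q ^ 2 := by
  have hc : ContinuousAt (fun q : ℝ => a * (a + 1) * (1 + q) ^ (-a - 2)) 0 := by
    refine continuousAt_const.mul (ContinuousAt.rpow_const (by fun_prop) ?_)
    left; norm_num
  have hev : ∀ᶠ q in 𝓝 (0 : ℝ), a * (a + 1) * (1 + q) ^ (-a - 2) < a * (a + 1) + 2 * ε :=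
    hc.eventually_lt continuousAt_const (by simp; linarith)
  obtain ⟨η₀, hη₀, hball⟩ := Metric.eventually_nhds_iff.1 hev
  set η := min (η₀ / 2) (1 / 2) with hη
  have hηpos : 0 < η := by positivity
  have hη1 : η < 1 := lt_of_le_of_lt (min_le_right _ _) (by norm_num)
  refine ⟨η, hηpos, hη1, ?_⟩
  set κ := a * (a + 1) / 2 + ε with hκ
  -- The gap `h` satisfies `h 0 = h' 0 = 0`, and the `ε` in `κ` makes `h'` monotone near `0`; so `h`
  -- is smallest at `0`.
  let h : ℝ → ℝ := fun q => 1 - a * q + κ * q ^ 2 - (1 + q) ^ (-a)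
  let h' : ℝ → ℝ := fun q => -a + κ * (2 * q) + a * (1 + q) ^ (-a - 1)
  have hd : ∀ q, |q| ≤ η → HasDerivAt h (h' q) q := by
    intro q hq
    have hq' : 0 < 1 + q := by have := (abs_le.1 hq).1; linarith
    have h1 : HasDerivAt (fun q : ℝ => (1 + q) ^ (-a)) (1 * (-a) * (1 + q) ^ (-a - 1)) q :=
      ((hasDerivAt_id q).const_add 1).rpow_const (Or.inl hq'.ne')
    have h2 : HasDerivAt (fun q : ℝ => 1 - a * q + κ * q ^ 2) (-a + κ * (2 * q)) q := by
      exact ((((hasDerivAt_id q).const_mul a).const_sub 1).add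
        (((hasDerivAt_id q).pow 2).const_mul κ)).congr_deriv (by simp)
    exact (h2.sub h1).congr_deriv (by simp only [h']; ring)
  have hd' : ∀ q, |q| ≤ η → HasDerivAt h' (κ * 2 - a * (a + 1) * (1 + q) ^ (-a - 2)) q := by
    intro q hq
    have hq' : 0 < 1 + q := by have := (abs_le.1 hq).1; linarith
    have h1 : HasDerivAt (fun q : ℝ => (1 + q) ^ (-a - 1))
        (1 * (-a - 1) * (1 + q) ^ (-a - 1 - 1)) q :=
      ((hasDerivAt_id q).const_add 1).rpow_const (Or.inl hq'.ne')
    have h2 : HasDerivAt (fun q : ℝ => -a + κ * (2 * q)) (κ * 2) q := by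
      exact ((((hasDerivAt_id q).const_mul 2).const_mul κ).const_add (-a)).congr_deriv
        (by ring)
    exact (h2.add (h1.const_mul a)).congr_deriv
      (by rw [show -a - 1 - 1 = -a - 2 by ring]; ring)
  have hint : ∀ {q}, q ∈ interior (Set.Icc (-η) η) → q ∈ Set.Icc (-η) η :=
    fun hq => interior_subset hq
  have hmono : MonotoneOn h' (Set.Icc (-η) η) := by
    refine monotoneOn_of_deriv_nonneg (convex_Icc _ _)
      (fun q hq => (hd' q (abs_le.2 hq)).continuousAt.continuousWithinAt)
      (fun q hq => (hd' q (abs_le.2 (hint hq))).differentiableAt.differentiableWithinAt)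
      (fun q hq => ?_)
    have hq := abs_le.2 (hint hq)
    rw [(hd' q hq).deriv]
    have := hball (y := q) (by
      rw [Real.dist_eq, sub_zero]
      exact lt_of_le_of_lt (hq.trans (min_le_left _ _)) (by linarith))
    rw [hκ]; linarith
  have h0 : h' 0 = 0 := by simp [h']
  have hh0 : h 0 = 0 := by simp [h]
  intro q hq
  suffices 0 ≤ h q by simp only [h] at this; linarith
  have hmem := abs_le.1 hq
  rcases le_total 0 q with hq0 | hq0
  · have : MonotoneOn h (Set.Icc 0 η) := by
      refine monotoneOn_of_deriv_nonneg (convex_Icc _ _)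
        (fun q hq => (hd q (abs_le.2 ⟨by linarith [hq.1], hq.2⟩)).continuousAt.continuousWithinAt)
        (fun q hq => ?_) (fun q hq => ?_) <;> have hq := interior_subset hq
      · exact (hd q (abs_le.2 ⟨by linarith [hq.1], hq.2⟩)).differentiableAt.differentiableWithinAt
      · rw [(hd q (abs_le.2 ⟨by linarith [hq.1], hq.2⟩)).deriv, ← h0]
        exact hmono ⟨by linarith, hηpos.le⟩ ⟨by linarith [hq.1], hq.2⟩ hq.1
    rw [← hh0]
    exact this ⟨le_rfl, hηpos.le⟩ ⟨hq0, hmem.2⟩ hq0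
  · have : AntitoneOn h (Set.Icc (-η) 0) := by
      refine antitoneOn_of_deriv_nonpos (convex_Icc _ _)
        (fun q hq => (hd q (abs_le.2 ⟨hq.1, by linarith [hq.2]⟩)).continuousAt.continuousWithinAt)
        (fun q hq => ?_) (fun q hq => ?_) <;> have hq := interior_subset hq
      · exact (hd q (abs_le.2 ⟨hq.1, by linarith [hq.2]⟩)).differentiableAt.differentiableWithinAt
      · rw [(hd q (abs_le.2 ⟨hq.1, by linarith [hq.2]⟩)).deriv, ← h0]
        exact hmono ⟨hq.1, by linarith [hq.2]⟩ ⟨by linarith, hηpos.le⟩ hq.2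
    rw [← hh0]
    exact this ⟨hmem.1, hq0⟩ ⟨by linarith, le_rfl⟩ hq0

/-- One-step bound for the kernel `x ↦ (x² + s²) ^ (-b/2)` under a small relative displacement,
uniform in `s`. -/
theorem kernel_step_le {b ε : ℝ} (hb : 0 < b) (hε : 0 < ε) :
    ∃ η : ℝ, 0 < η ∧ η < 1 ∧ ∀ x s J : ℝ, 0 < x → |J| ≤ η * x →
      ((x + J) ^ 2 + s ^ 2) ^ (-(b / 2)) ≤ (x ^ 2 + s ^ 2) ^ (-(b / 2)) *
        (1 - b / (x ^ 2 + s ^ 2) * (x * J - ((b + 1) / 2 + ε) * J ^ 2)) := by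
  obtain ⟨η₀, h0, h1, hη⟩ := one_add_rpow_neg_le (a := b / 2) (ε := b * ε / 8) (by positivity)
  set κ := b / 2 * (b / 2 + 1) / 2 + b * ε / 8 with hκ
  have hκ0 : 0 < κ := by positivity
  -- The first entry keeps `|q| ≤ 3 η ≤ η₀`; the second makes the excess `5 η κ` in the bound for `κ
  -- q²` at most `b ε / 2`. Only `x² ≤ w` enters, so `η` does not depend on `s`.
  set η := min (η₀ / 3) (b * ε / (10 * κ)) with hηdef
  have hηp : 0 < η := by positivity
  have hη3 : 3 * η ≤ η₀ := by have := min_le_left (η₀ / 3) (b * ε / (10 * κ)); linarith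
  have hηκ : κ * (5 * η) ≤ b * ε / 2 := by
    have : η ≤ b * ε / (10 * κ) := min_le_right _ _
    rw [le_div_iff₀ (by positivity)] at this
    linarith
  have hη1 : η < 1 := by linarith
  refine ⟨η, hηp, hη1, fun x s J hx hJ => ?_⟩
  set w := x ^ 2 + s ^ 2 with hw
  have hxw : x ^ 2 ≤ w := by rw [hw]; nlinarith [sq_nonneg s]
  have hw0 : 0 < w := lt_of_lt_of_le (by positivity) hxw
  set q := (2 * x * J + J ^ 2) / w with hq
  have hJ2 : J ^ 2 ≤ η * x * |J| := by
    rw [← sq_abs, sq]; exact mul_le_mul_of_nonneg_right hJ (abs_nonneg J)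
  have hJ2' : J ^ 2 ≤ η * x ^ 2 := by
    calc J ^ 2 ≤ η * x * |J| := hJ2
      _ ≤ η * x * (η * x) := by gcongr
      _ ≤ η * x * (1 * x) := by gcongr
      _ = η * x ^ 2 := by ring
  have hqη : |q| ≤ η₀ := by
    rw [hq, abs_div, abs_of_pos hw0, div_le_iff₀ hw0]
    calc |2 * x * J + J ^ 2| ≤ |2 * x * J| + |J ^ 2| := abs_add_le _ _
      _ = 2 * x * |J| + J ^ 2 := by
        rw [abs_mul, abs_of_pos (by positivity : 0 < 2 * x), abs_of_nonneg (sq_nonneg J)]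
      _ ≤ 2 * x * (η * x) + η * x ^ 2 := by gcongr
      _ = 3 * η * x ^ 2 := by ring
      _ ≤ η₀ * w := by gcongr
  have hfac : (x + J) ^ 2 + s ^ 2 = w * (1 + q) := by
    rw [hq]; field_simp; rw [hw]; ring
  have hq1 : 0 ≤ 1 + q := by have := (abs_le.1 hqη).1; linarith
  rw [hfac, Real.mul_rpow hw0.le hq1]
  refine mul_le_mul_of_nonneg_left ((hη q hqη).trans ?_) (Real.rpow_nonneg hw0.le _)
  have hq2 : q ^ 2 ≤ (4 + 5 * η) * (J ^ 2 / w) := by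
    rw [hq, div_pow, div_le_iff₀ (by positivity)]
    have : (2 * x * J + J ^ 2) ^ 2 ≤ (4 + 5 * η) * x ^ 2 * J ^ 2 := by
      have e1 : x * J ≤ η * x ^ 2 := by
        calc x * J ≤ x * |J| := by gcongr; exact le_abs_self J
          _ ≤ x * (η * x) := by gcongr
          _ = _ := by ring
      have : (2 * x * J + J ^ 2) ^ 2 = (4 * x ^ 2 + 4 * (x * J) + J ^ 2) * J ^ 2 := by ring
      rw [this]
      gcongr
      linarith
    calc (2 * x * J + J ^ 2) ^ 2 ≤ (4 + 5 * η) * x ^ 2 * J ^ 2 := this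
      _ ≤ (4 + 5 * η) * w * J ^ 2 := by gcongr
      _ = (4 + 5 * η) * (J ^ 2 / w) * w ^ 2 := by field_simp
  have hfin : κ * q ^ 2 ≤ (b * (b + 2) / 2 + b * ε) * (J ^ 2 / w) := by
    have h5 : 0 ≤ J ^ 2 / w := by positivity
    calc κ * q ^ 2 ≤ κ * ((4 + 5 * η) * (J ^ 2 / w)) := by gcongr
      _ = (4 * κ + κ * (5 * η)) * (J ^ 2 / w) := by ring
      _ ≤ (4 * κ + b * ε / 2) * (J ^ 2 / w) := by gcongr
      _ = (b * (b + 2) / 2 + b * ε) * (J ^ 2 / w) := by rw [hκ]; ring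
  -- The `J²` inside `q` also enters at first order; it lowers the coefficient `b (b + 2) / 2` to `b
  -- (b + 1) / 2`.
  have : b / 2 * q = b * (x * J) / w + b / 2 * (J ^ 2 / w) := by rw [hq]; ring
  calc 1 - b / 2 * q + κ * q ^ 2
      ≤ 1 - (b * (x * J) / w + b / 2 * (J ^ 2 / w)) + (b * (b + 2) / 2 + b * ε) * (J ^ 2 / w) := by
        rw [← this]; gcongr
    _ = 1 - b / w * (x * J - ((b + 1) / 2 + ε) * J ^ 2) := by ring

/-! ### The premium rate up to `o(1 / z)` -/

/-- An antitone function integrable at infinity is `o(1 / z)`. -/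
theorem antitone_integrable_le_div {p : ℝ → ℝ}
    (hanti : AntitoneOn p (Set.Ioi 1)) (hint : IntegrableAtFilter p atTop volume)
    {ε : ℝ} (hε : 0 < ε) : ∀ᶠ z in atTop, p z ≤ ε / z := by
  obtain ⟨s, hs, hint⟩ := hint
  obtain ⟨A, hA⟩ := mem_atTop_sets.1 hs
  set B := max A 2
  have hint : IntegrableOn p (Set.Ioi B) :=
    hint.mono_set fun z hz => hA z ((le_max_left _ _).trans (le_of_lt hz))
  have hlim := intervalIntegral_tendsto_integral_Ioi B hint tendsto_id
  have hlim2 : Tendsto (fun z : ℝ => ∫ y in B..(z / 2), p y) atTop (𝓝 (∫ y in Set.Ioi B, p y)) :=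
    hlim.comp (tendsto_id.atTop_div_const (by norm_num))
  -- The mass on `[z / 2, z]` tends to `0`, while monotonicity bounds it below by `(z / 2) p z`.
  have hsub := hlim.sub hlim2
  rw [sub_self] at hsub
  have hev : ∀ᶠ z in atTop, (∫ y in B..z, p y) - (∫ y in B..(z / 2), p y) < ε / 2 :=
    hsub.eventually_lt_const (by positivity)
  filter_upwards [hev, eventually_gt_atTop (2 * B)] with z hz hzB
  have hB2 : 2 ≤ B := le_max_right _ _
  have hii : ∀ u, B ≤ u → IntervalIntegrable p volume B u := fun u hu =>
    (intervalIntegrable_iff_integrableOn_Ioc_of_le hu).2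
      (hint.mono_set Set.Ioc_subset_Ioi_self)
  rw [intervalIntegral.integral_interval_sub_left (hii z (by linarith))
    (hii (z / 2) (by linarith))] at hz
  have hii2 : IntervalIntegrable p volume (z / 2) z :=
    (hii (z / 2) (by linarith)).symm.trans (hii z (by linarith))
  have hlow : ∫ _ in (z / 2)..z, p z ≤ ∫ y in (z / 2)..z, p y := by
    refine intervalIntegral.integral_mono_on (by linarith) (by simp) hii2 fun y hy => ?_
    exact hanti (show (1 : ℝ) < y by linarith [hy.1]) (show (1 : ℝ) < z by linarith) hy.2
  rw [intervalIntegral.integral_const, smul_eq_mul] at hlow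
  rw [le_div_iff₀ (by linarith)]
  linarith

/-- An error `o(1 / z)` is all that the ruin estimates need from the function `p`. -/
theorem ApproachesAtRate.eventually {v : ℝ → ℝ} {c θ : ℝ} (h : ApproachesAtRate v c θ)
    {ε : ℝ} (hε : 0 < ε) : ∀ᶠ z in atTop, |v z - c - θ / z| ≤ ε / z := by
  obtain ⟨p, _, hanti, hint, hle⟩ := h
  filter_upwards [antitone_integrable_le_div hanti hint hε, eventually_gt_atTop 1] with z h1 h2
  exact (hle z h2).trans h1

/-! ### Dyadic estimates for regularly varying tails -/

/-- Summing a dyadic bound: if `F` loses a factor less than `1/4` at each doubling, and the mass of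
`g` on `(y, 2y]` is at most `A y² F(y)`, then the mass of `g` on `(x, ∞)` is `O(x² F(x))`. -/
theorem lintegral_Ioi_le_of_dyadic {F : ℝ → ℝ} {X r : ℝ} (hX : 0 < X) (hr : 0 ≤ r)
    (hr4 : 4 * r < 1) (hF0 : ∀ x, 0 ≤ F x) (hF : ∀ x, X ≤ x → F (2 * x) ≤ r * F x)
    {m : Measure ℝ} {g : ℝ → ENNReal} {A : ℝ} (hA : 0 ≤ A)
    (hg : ∀ y, X ≤ y → ∫⁻ s in Set.Ioc y (2 * y), g s ∂m ≤ ENNReal.ofReal (A * (y ^ 2 * F y)))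
    {x : ℝ} (hx : X ≤ x) :
    ∫⁻ s in Set.Ioi x, g s ∂m ≤ ENNReal.ofReal (A / (1 - 4 * r) * (x ^ 2 * F x)) := by
  have hx0 : 0 < x := hX.trans_le hx
  have hpow : ∀ k : ℕ, X ≤ 2 ^ k * x := fun k =>
    hx.trans (le_mul_of_one_le_left hx0.le (one_le_pow₀ (by norm_num)))
  have hFk : ∀ k : ℕ, F (2 ^ k * x) ≤ r ^ k * F x := by
    intro k
    induction k with
    | zero => simp
    | succ k ih =>
      calc F (2 ^ (k + 1) * x) = F (2 * (2 ^ k * x)) := by ring_nf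
        _ ≤ r * F (2 ^ k * x) := hF _ (hpow k)
        _ ≤ r * (r ^ k * F x) := by gcongr
        _ = r ^ (k + 1) * F x := by ring
  have hcov : Set.Ioi x ⊆ ⋃ k : ℕ, Set.Ioc (2 ^ k * x) (2 * (2 ^ k * x)) := by
    intro s hs
    obtain ⟨n, hn1, hn2⟩ := exists_nat_pow_near_of_lt_one (y := (1 : ℝ) / 2) (x := x / s)
      (div_pos hx0 (hx0.trans hs)) ((div_le_one (hx0.trans hs)).2 (le_of_lt hs)) (by norm_num)
      (by norm_num)
    have hs0 : 0 < s := hx0.trans hs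
    rw [one_div, inv_pow] at hn1 hn2
    rcases hn2.lt_or_eq with h | h
    · refine Set.mem_iUnion.2 ⟨n, ?_, ?_⟩
      · rw [div_lt_iff₀ hs0, inv_mul_eq_div, lt_div_iff₀ (by positivity)] at h
        linarith
      · rw [lt_div_iff₀ hs0, inv_mul_eq_div, div_lt_iff₀ (by positivity), pow_succ] at hn1
        linarith
    -- The endpoint `s = 2 ^ n * x` belongs to the half-open block with index `n - 1`; `n = 0` is
    -- excluded by `x < s`.
    · rw [div_eq_iff hs0.ne', inv_mul_eq_div, eq_div_iff (by positivity)] at h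
      cases n with
      | zero => simp at h; exact absurd hs (by simp [h])
      | succ k =>
        refine Set.mem_iUnion.2 ⟨k, ?_, ?_⟩ <;> rw [← h, pow_succ] <;>
          nlinarith [show (0 : ℝ) < 2 ^ k * x by positivity]
  calc ∫⁻ s in Set.Ioi x, g s ∂m
      ≤ ∫⁻ s in ⋃ k : ℕ, Set.Ioc (2 ^ k * x) (2 * (2 ^ k * x)), g s ∂m := lintegral_mono_set hcov
    _ ≤ ∑' k : ℕ, ∫⁻ s in Set.Ioc (2 ^ k * x) (2 * (2 ^ k * x)), g s ∂m := lintegral_iUnion_le _ _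
    _ ≤ ∑' k : ℕ, ENNReal.ofReal (A * (x ^ 2 * F x) * (4 * r) ^ k) := by
        refine ENNReal.tsum_le_tsum fun k => (hg _ (hpow k)).trans (ENNReal.ofReal_le_ofReal ?_)
        calc A * ((2 ^ k * x) ^ 2 * F (2 ^ k * x)) ≤ A * ((2 ^ k * x) ^ 2 * (r ^ k * F x)) := by
              gcongr; exact hFk k
          _ = A * (x ^ 2 * F x) * (4 * r) ^ k := by
              rw [mul_pow, ← pow_mul, mul_comm k 2, pow_mul, mul_pow]; norm_num; ring
    _ = ENNReal.ofReal (A / (1 - 4 * r) * (x ^ 2 * F x)) := by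
        have := hF0 x
        rw [← ENNReal.ofReal_tsum_of_nonneg (fun k => by positivity)
          ((summable_geometric_of_lt_one (by positivity) hr4).mul_left _), tsum_mul_left,
          tsum_geometric_of_lt_one (by positivity) hr4]
        congr 1
        ring

/-- Truncated moments of order `2 + b` of a distribution whose tail loses a factor of more than
`2 ^ (-2 - b)` at each doubling. -/
theorem lintegral_Ioc_rpow_le {ν : Measure ℝ} [IsProbabilityMeasure ν] {b X r : ℝ} (hb : 0 < b)
    (hX : 0 < X) (hrb : 1 < r * 2 ^ (2 + b)) (hF0 : ∀ x, 0 < ν.real (Set.Ioi x))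
    (hF : ∀ x, X ≤ x → r * ν.real (Set.Ioi x) ≤ ν.real (Set.Ioi (2 * x))) :
    ∃ K : ℝ, 0 < K ∧ ∀ x, X ≤ x → ∫⁻ s in Set.Ioc 0 x, ENNReal.ofReal (|s| ^ (2 + b)) ∂ν ≤
      ENNReal.ofReal (K * (x ^ (2 + b) * ν.real (Set.Ioi x))) := by
  set F : ℝ → ℝ := fun x => ν.real (Set.Ioi x) with hFdef
  have hanti : Antitone F := fun x y hxy => measureReal_mono (Set.Ioi_subset_Ioi hxy)
  set q : ℝ := r * 2 ^ (2 + b) with hq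
  -- `K₁` covers `x` in `[X, 2 X]`. `K₂` solves `K + 2 ^ (2 + b) = K q`, which closes the induction
  -- on doublings because `q > 1`.
  set K₁ := (2 * X) ^ (2 + b) / (X ^ (2 + b) * F (2 * X)) with hK₁
  set K₂ := 2 ^ (2 + b) / (q - 1) with hK₂
  have h2 : (0 : ℝ) < 2 ^ (2 + b) := by positivity
  have hFX : 0 < F (2 * X) := hF0 _
  have hK₁0 : 0 < K₁ := by positivity
  have hK₂0 : 0 < K₂ := div_pos h2 (by linarith)
  set K := max K₁ K₂
  have hK0 : 0 < K := hK₁0.trans_le (le_max_left _ _)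
  have hbdd : ∀ u w : ℝ, 0 ≤ u → ∫⁻ s in Set.Ioc u w, ENNReal.ofReal (|s| ^ (2 + b)) ∂ν ≤
      ENNReal.ofReal (w ^ (2 + b) * F u) := by
    intro u w hu
    calc ∫⁻ s in Set.Ioc u w, ENNReal.ofReal (|s| ^ (2 + b)) ∂ν
        ≤ ∫⁻ s in Set.Ioc u w, ENNReal.ofReal (w ^ (2 + b)) ∂ν := by
          refine setLIntegral_mono measurable_const fun s hs => ENNReal.ofReal_le_ofReal ?_
          rw [abs_of_pos (hu.trans_lt hs.1)]
          exact Real.rpow_le_rpow (hu.trans hs.1.le) hs.2 (by linarith)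
      _ = ENNReal.ofReal (w ^ (2 + b)) * ν (Set.Ioc u w) := by simp
      _ ≤ ENNReal.ofReal (w ^ (2 + b)) * ν (Set.Ioi u) := by gcongr; exact Set.Ioc_subset_Ioi_self
      _ = ENNReal.ofReal (w ^ (2 + b) * F u) := by
          rcases le_or_gt 0 w with hw | hw
          · rw [ENNReal.ofReal_mul (Real.rpow_nonneg hw _), hFdef, ofReal_measureReal]
          · rw [ENNReal.ofReal_mul' (hF0 u).le, ofReal_measureReal]
  have key : ∀ n : ℕ, ∀ x, X ≤ x → x ≤ 2 * X →
      ∫⁻ s in Set.Ioc 0 (2 ^ n * x), ENNReal.ofReal (|s| ^ (2 + b)) ∂ν ≤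
      ENNReal.ofReal (K * ((2 ^ n * x) ^ (2 + b) * F (2 ^ n * x))) := by
    intro n x hx hx2
    have hx0 : 0 < x := hX.trans_le hx
    induction n with
    | zero =>
      rw [pow_zero, one_mul]
      refine (hbdd 0 x le_rfl).trans (ENNReal.ofReal_le_ofReal ?_)
      calc x ^ (2 + b) * F 0 ≤ (2 * X) ^ (2 + b) * 1 := by
            gcongr; exact measureReal_le_one
        _ = K₁ * (X ^ (2 + b) * F (2 * X)) := by rw [hK₁]; field_simp
        _ ≤ K * (x ^ (2 + b) * F x) := by
            gcongr
            · exact le_max_left _ _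
            · exact hanti hx2
    | succ n ih =>
      set y := 2 ^ n * x with hy
      have hy0 : 0 < y := by positivity
      have hXy : X ≤ y := hx.trans (le_mul_of_one_le_left hx0.le (one_le_pow₀ (by norm_num)))
      have e : (2 : ℝ) ^ (n + 1) * x = 2 * y := by rw [hy]; ring
      rw [e, ← Set.Ioc_union_Ioc_eq_Ioc hy0.le (show y ≤ 2 * y by linarith)]
      refine (lintegral_union_le _ _ _).trans ((add_le_add ih (hbdd y (2 * y) hy0.le)).trans ?_)
      have := hF0 y
      have hyb : 0 < y ^ (2 + b) := by positivity
      rw [← ENNReal.ofReal_add (by positivity) (by positivity)]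
      refine ENNReal.ofReal_le_ofReal ?_
      have hKq : K + 2 ^ (2 + b) ≤ K * q := by
        have : K₂ ≤ K := le_max_right _ _
        rw [hK₂, div_le_iff₀ (by linarith)] at this
        linarith
      calc K * (y ^ (2 + b) * F y) + (2 * y) ^ (2 + b) * F y
          = (K + 2 ^ (2 + b)) * (y ^ (2 + b) * F y) := by
            rw [Real.mul_rpow (by norm_num) hy0.le]; ring
        _ ≤ K * q * (y ^ (2 + b) * F y) := by gcongr
        _ = K * ((2 * y) ^ (2 + b) * (r * F y)) := by
            rw [hq, Real.mul_rpow (by norm_num) hy0.le]; ring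
        _ ≤ K * ((2 * y) ^ (2 + b) * F (2 * y)) := by
            gcongr
            exact hF y hXy
  refine ⟨K, hK0, fun x hx => ?_⟩
  obtain ⟨n, hn1, hn2⟩ := exists_nat_pow_near (x := x / X) (y := 2) ((one_le_div hX).2 hx)
    (by norm_num)
  rw [le_div_iff₀ hX] at hn1
  rw [div_lt_iff₀ hX, pow_succ] at hn2
  have := key n (x / 2 ^ n) (by rw [le_div_iff₀ (by positivity)]; linarith)
    (by rw [div_le_iff₀ (by positivity)]; linarith)
  rwa [mul_div_cancel₀ _ (by positivity)] at this

/-- Ratios of a regularly varying tail under doubling. -/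
theorem tendsto_ratio_two_of_slowlyVarying {F L : ℝ → ℝ} {a : ℝ} (hL : SlowlyVarying L)
    (hF : ∀ x, 0 < x → F x = x ^ a * L x) :
    Tendsto (fun x => F (2 * x) / F x) atTop (𝓝 (2 ^ a)) := by
  have := (hL.2.2 2 (by norm_num)).const_mul ((2 : ℝ) ^ a)
  rw [mul_one] at this
  refine this.congr' ?_
  filter_upwards [eventually_gt_atTop 0] with x hx
  rw [hF x hx, hF _ (by positivity), Real.mul_rpow (by norm_num) hx.le]
  have : x ^ a ≠ 0 := by positivity
  field_simp

/-! ### The Lyapunov function and its size -/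

/-- The mixing kernel of the Lyapunov function. -/
noncomputable def mixKernel (b x s : ℝ) : ℝ := |s| ^ (2 + b) * (x ^ 2 + s ^ 2) ^ (-(b / 2))

/-- The Lyapunov function: a mixture of kernels over the claim size distribution. -/
noncomputable def lyapunov (ν : Measure ℝ) (b x : ℝ) : ENNReal :=
  ∫⁻ s, ENNReal.ofReal (mixKernel b x s) ∂ν

theorem mixKernel_nonneg (b x s : ℝ) : 0 ≤ mixKernel b x s := by
  unfold mixKernel; positivity

theorem measurable_mixKernel (b : ℝ) : Measurable fun p : ℝ × ℝ => mixKernel b p.1 p.2 := by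
  unfold mixKernel
  have : Measurable fun s : ℝ => |s| := continuous_abs.measurable
  exact ((this.comp measurable_snd).pow_const _).mul
    (((measurable_fst.pow_const 2).add (measurable_snd.pow_const 2)).pow_const _)

theorem measurable_lyapunov (ν : Measure ℝ) [SFinite ν] (b : ℝ) : Measurable (lyapunov ν b) :=
  (measurable_mixKernel b).ennreal_ofReal.lintegral_prod_right'

theorem mixKernel_antitone {b : ℝ} (hb : 0 < b) {x y : ℝ} (hx : 0 < x) (hxy : x ≤ y) (s : ℝ) :
    mixKernel b y s ≤ mixKernel b x s := by
  unfold mixKernel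
  refine mul_le_mul_of_nonneg_left ?_ (by positivity)
  exact Real.rpow_le_rpow_of_nonpos (by positivity) (by gcongr) (by linarith)

theorem lyapunov_antitone (ν : Measure ℝ) {b : ℝ} (hb : 0 < b) {x y : ℝ} (hx : 0 < x)
    (hxy : x ≤ y) : lyapunov ν b y ≤ lyapunov ν b x :=
  lintegral_mono fun s => ENNReal.ofReal_le_ofReal (mixKernel_antitone hb hx hxy s)

/-- This bound has the right order for `|s| ≥ x`. It is uniform in `x`, so it also serves as the
dominating function that makes the mixture finite and lets it vanish at infinity. -/
theorem mixKernel_le_sq {b : ℝ} (hb : 0 < b) {x : ℝ} (hx : 0 < x) (s : ℝ) :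
    mixKernel b x s ≤ s ^ 2 := by
  unfold mixKernel
  have h1 : |s| ^ (2 + b) = s ^ 2 * (s ^ 2) ^ (b / 2) := by
    rw [← sq_abs, ← Real.rpow_natCast, ← Real.rpow_mul (abs_nonneg _)]
    rw [Real.rpow_add_of_nonneg (abs_nonneg _) (by norm_num) hb.le]
    congr 2
    push_cast; ring
  have h2 : 0 < x ^ 2 + s ^ 2 := by positivity
  rw [h1, Real.rpow_neg h2.le, mul_assoc]
  refine mul_le_of_le_one_right (sq_nonneg s) ?_
  rw [← div_eq_mul_inv, div_le_one (by positivity)]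
  exact Real.rpow_le_rpow (sq_nonneg s) (by nlinarith) (by positivity)

/-- The complementary bound, of the right order for `|s| ≤ x`. -/
theorem mixKernel_le_rpow {b : ℝ} (hb : 0 < b) {x : ℝ} (hx : 0 < x) (s : ℝ) :
    mixKernel b x s ≤ |s| ^ (2 + b) * x ^ (-b) := by
  unfold mixKernel
  gcongr
  calc (x ^ 2 + s ^ 2) ^ (-(b / 2)) ≤ (x ^ 2) ^ (-(b / 2)) :=
        Real.rpow_le_rpow_of_nonpos (by positivity) (by nlinarith [sq_nonneg s]) (by linarith)
    _ = x ^ (-b) := by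
        rw [← Real.rpow_natCast, ← Real.rpow_mul hx.le]; congr 1; push_cast; ring

theorem tail_antitone (ν : Measure ℝ) [IsFiniteMeasure ν] :
    Antitone fun x => ν.real (Set.Ioi x) :=
  fun _ _ hxy => measureReal_mono (Set.Ioi_subset_Ioi hxy)

theorem tail_pos {ν : Measure ℝ} [IsProbabilityMeasure ν] {β : ℝ} {L : ℝ → ℝ}
    (hL : SlowlyVarying L) (hF : ∀ x, 0 < x → ν.real (Set.Ioi x) = x ^ (-2 - β) * L x) (x : ℝ) :
    0 < ν.real (Set.Ioi x) := by
  obtain ⟨y, hy1, hy2, hy3⟩ :=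
    (hL.2.1.and ((eventually_gt_atTop 0).and (eventually_ge_atTop x))).exists
  refine lt_of_lt_of_le ?_ (tail_antitone ν hy3)
  simp only
  rw [hF y hy2]
  positivity

/-- The limiting ratio `2 ^ (-2 - β)` lies strictly between `2 ^ (-2 - b)` and `1/4`, as `0 < β <
b`. The bound by `r₁` makes second-moment tails summable over dyadic blocks; the bound by `r₂` makes
truncated moments of order `2 + b` be dominated by their last block. -/
theorem tail_dyadic {ν : Measure ℝ} [IsProbabilityMeasure ν] {β b : ℝ} {L : ℝ → ℝ} (hβ : 0 < β)
    (hb : β < b) (hL : SlowlyVarying L)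
    (hF : ∀ x, 0 < x → ν.real (Set.Ioi x) = x ^ (-2 - β) * L x) :
    ∃ X r₁ r₂ : ℝ, 0 < X ∧ 0 < r₁ ∧ 4 * r₁ < 1 ∧ 0 < r₂ ∧ 1 < r₂ * 2 ^ (2 + b) ∧
      ∀ x, X ≤ x → ν.real (Set.Ioi (2 * x)) ≤ r₁ * ν.real (Set.Ioi x) ∧
        r₂ * ν.real (Set.Ioi x) ≤ ν.real (Set.Ioi (2 * x)) := by
  have hlim := tendsto_ratio_two_of_slowlyVarying (F := fun x => ν.real (Set.Ioi x)) hL hF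
  have h4 : (2 : ℝ) ^ (-2 - β) < 1 / 4 := by
    calc (2 : ℝ) ^ (-2 - β) < 2 ^ (-2 : ℝ) :=
          Real.rpow_lt_rpow_of_exponent_lt (by norm_num) (by linarith)
      _ = 1 / 4 := by rw [Real.rpow_neg (by norm_num)]; norm_num
  have hb' : (2 : ℝ) ^ (-2 - b) < 2 ^ (-2 - β) :=
    Real.rpow_lt_rpow_of_exponent_lt (by norm_num) (by linarith)
  obtain ⟨r₁, h1, h1'⟩ := exists_between h4
  obtain ⟨r₂, h2, h2'⟩ := exists_between hb'
  have hev := (hlim.eventually_lt_const h1).and (hlim.eventually_const_lt h2')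
  obtain ⟨X, hX⟩ := eventually_atTop.1 hev
  have hp : (0 : ℝ) < 2 ^ (-2 - β) := by positivity
  have hpb : (0 : ℝ) < 2 ^ (-2 - b) := by positivity
  refine ⟨max X 1, r₁, r₂, by positivity, hp.trans h1, by linarith, hpb.trans h2, ?_,
    fun x hx => ?_⟩
  · calc (1 : ℝ) = 2 ^ (-2 - b) * 2 ^ (2 + b) := by
          rw [← Real.rpow_add (by norm_num)]; ring_nf; simp
      _ < r₂ * 2 ^ (2 + b) := by gcongr
  · have := hX x ((le_max_left _ _).trans hx)
    have hpos := tail_pos hL hF x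
    rw [div_lt_iff₀ hpos, lt_div_iff₀ hpos] at this
    exact ⟨this.1.le, this.2.le⟩

/-- The tail is comparable with itself under scaling of the argument. -/
theorem tail_scale {ν : Measure ℝ} [IsProbabilityMeasure ν] {β : ℝ} {L : ℝ → ℝ} (hβ : 0 < β)
    (hL : SlowlyVarying L) (hF : ∀ x, 0 < x → ν.real (Set.Ioi x) = x ^ (-2 - β) * L x) (A : ℝ) :
    ∃ X c : ℝ, 0 < X ∧ 0 < c ∧ ∀ x, X ≤ x → c * ν.real (Set.Ioi x) ≤ ν.real (Set.Ioi (A * x)) := by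
  obtain ⟨X, r₁, r₂, hX, -, -, hr₂, -, h⟩ := tail_dyadic hβ (lt_add_one β) hL hF
  obtain ⟨n, hn⟩ := pow_unbounded_of_one_lt A (one_lt_two (α := ℝ))
  refine ⟨X, r₂ ^ n, hX, by positivity, fun x hx => ?_⟩
  have hx0 : 0 < x := hX.trans_le hx
  have key : ∀ n : ℕ, r₂ ^ n * ν.real (Set.Ioi x) ≤ ν.real (Set.Ioi (2 ^ n * x)) := by
    intro n
    induction n with
    | zero => simp
    | succ n ih =>
      calc r₂ ^ (n + 1) * ν.real (Set.Ioi x) = r₂ * (r₂ ^ n * ν.real (Set.Ioi x)) := by ring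
        _ ≤ r₂ * ν.real (Set.Ioi (2 ^ n * x)) := by gcongr
        _ ≤ ν.real (Set.Ioi (2 * (2 ^ n * x))) :=
          (h _ (hx.trans (le_mul_of_one_le_left hx0.le (one_le_pow₀ (by norm_num))))).2
        _ = ν.real (Set.Ioi (2 ^ (n + 1) * x)) := by ring_nf
  exact (key n).trans (tail_antitone ν (by gcongr))

/-- One half of Karamata's theorem, up to constants: a block `(y, 2 y]` contributes at most `4 y²`
times the tail at `y`. -/
theorem lintegral_sq_Ioi_le {ν : Measure ℝ} [IsProbabilityMeasure ν] {β : ℝ} {L : ℝ → ℝ}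
    (hβ : 0 < β) (hL : SlowlyVarying L)
    (hF : ∀ x, 0 < x → ν.real (Set.Ioi x) = x ^ (-2 - β) * L x) :
    ∃ X C : ℝ, 0 < X ∧ 0 < C ∧ ∀ x, X ≤ x → ∫⁻ s in Set.Ioi x, ENNReal.ofReal (s ^ 2) ∂ν ≤
      ENNReal.ofReal (C * (x ^ 2 * ν.real (Set.Ioi x))) := by
  obtain ⟨X, r₁, r₂, hX, hr₁, hr4, -, -, h⟩ := tail_dyadic hβ (lt_add_one β) hL hF
  refine ⟨X, 4 / (1 - 4 * r₁), hX, div_pos (by norm_num) (by linarith), fun x hx => ?_⟩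
  refine lintegral_Ioi_le_of_dyadic (F := fun x => ν.real (Set.Ioi x)) hX hr₁.le hr4
    (fun x => measureReal_nonneg) (fun x hx => (h x hx).1) (by norm_num) (fun y hy => ?_) hx
  have hy0 : 0 < y := hX.trans_le hy
  calc ∫⁻ s in Set.Ioc y (2 * y), ENNReal.ofReal (s ^ 2) ∂ν
      ≤ ∫⁻ s in Set.Ioc y (2 * y), ENNReal.ofReal ((2 * y) ^ 2) ∂ν := by
        refine setLIntegral_mono measurable_const fun s hs => ENNReal.ofReal_le_ofReal ?_
        have := hy0.trans hs.1
        gcongr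
        exact hs.2
    _ = ENNReal.ofReal ((2 * y) ^ 2) * ν (Set.Ioc y (2 * y)) := by simp
    _ ≤ ENNReal.ofReal ((2 * y) ^ 2) * ν (Set.Ioi y) := by
        gcongr; exact Set.Ioc_subset_Ioi_self
    _ = ENNReal.ofReal (4 * (y ^ 2 * ν.real (Set.Ioi y))) := by
        rw [← ofReal_measureReal, ← ENNReal.ofReal_mul (by positivity)]
        congr 1; ring

theorem lintegral_mul_tail_Ioi_le {ν : Measure ℝ} [IsProbabilityMeasure ν] {β : ℝ} {L : ℝ → ℝ}
    (hβ : 0 < β) (hL : SlowlyVarying L)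
    (hF : ∀ x, 0 < x → ν.real (Set.Ioi x) = x ^ (-2 - β) * L x) :
    ∃ X C : ℝ, 0 < X ∧ 0 < C ∧ ∀ x, X ≤ x →
      ∫⁻ y in Set.Ioi x, ENNReal.ofReal (y * ν.real (Set.Ioi y)) ≤
      ENNReal.ofReal (C * (x ^ 2 * ν.real (Set.Ioi x))) := by
  obtain ⟨X, r₁, r₂, hX, hr₁, hr4, -, -, h⟩ := tail_dyadic hβ (lt_add_one β) hL hF
  refine ⟨X, 2 / (1 - 4 * r₁), hX, div_pos (by norm_num) (by linarith), fun x hx => ?_⟩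
  refine lintegral_Ioi_le_of_dyadic (F := fun x => ν.real (Set.Ioi x)) hX hr₁.le hr4
    (fun x => measureReal_nonneg) (fun x hx => (h x hx).1) (by norm_num) (fun y hy => ?_) hx
  have hy0 : 0 < y := hX.trans_le hy
  calc ∫⁻ s in Set.Ioc y (2 * y), ENNReal.ofReal (s * ν.real (Set.Ioi s))
      ≤ ∫⁻ s in Set.Ioc y (2 * y), ENNReal.ofReal (2 * y * ν.real (Set.Ioi y)) := by
        refine setLIntegral_mono measurable_const fun s hs => ENNReal.ofReal_le_ofReal ?_
        exact mul_le_mul hs.2 (tail_antitone ν hs.1.le) measureReal_nonneg (by positivity)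
    _ = ENNReal.ofReal (2 * y * ν.real (Set.Ioi y)) * ENNReal.ofReal y := by
        rw [setLIntegral_const, Real.volume_Ioc]; congr 2; ring
    _ = ENNReal.ofReal (2 * (y ^ 2 * ν.real (Set.Ioi y))) := by
        rw [← ENNReal.ofReal_mul (by positivity)]
        congr 1; ring

/-- The finite variance of the claim size comes from `β > 0`. -/
theorem lintegral_sq_lt_top {ν : Measure ℝ} [IsProbabilityMeasure ν] (hν : ν (Set.Iio 0) = 0)
    {β : ℝ} {L : ℝ → ℝ} (hβ : 0 < β) (hL : SlowlyVarying L)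
    (hF : ∀ x, 0 < x → ν.real (Set.Ioi x) = x ^ (-2 - β) * L x) :
    ∫⁻ s, ENNReal.ofReal (s ^ 2) ∂ν < ⊤ := by
  obtain ⟨X, C, hX, -, h⟩ := lintegral_sq_Ioi_le hβ hL hF
  have hcov : (Set.univ : Set ℝ) ⊆ Set.Iio 0 ∪ (Set.Icc 0 X ∪ Set.Ioi X) := by
    intro s _
    rcases lt_or_ge s 0 with h | h
    · exact Or.inl h
    · rcases le_or_gt s X with h' | h'
      · exact Or.inr (Or.inl ⟨h, h'⟩)
      · exact Or.inr (Or.inr h')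
  rw [← setLIntegral_univ]
  refine (lintegral_mono_set hcov).trans_lt ((lintegral_union_le _ _ _).trans_lt ?_)
  rw [setLIntegral_measure_zero _ _ hν, zero_add]
  refine (lintegral_union_le _ _ _).trans_lt (ENNReal.add_lt_top.2 ⟨?_, ?_⟩)
  · calc ∫⁻ s in Set.Icc 0 X, ENNReal.ofReal (s ^ 2) ∂ν
        ≤ ∫⁻ s in Set.Icc 0 X, ENNReal.ofReal (X ^ 2) ∂ν := by
          refine setLIntegral_mono measurable_const fun s hs => ENNReal.ofReal_le_ofReal ?_
          have := hs.1
          gcongr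
          exact hs.2
      _ = ENNReal.ofReal (X ^ 2) * ν (Set.Icc 0 X) := by simp
      _ < ⊤ := ENNReal.mul_lt_top ENNReal.ofReal_lt_top (measure_lt_top _ _)
  · exact (h X le_rfl).trans_lt ENNReal.ofReal_lt_top

/-- Split at `s = x`. Below, the truncated moment of order `2 + b` times `x ^ (-b)` has order `x²
F(x)` because `b > β`; above, the second-moment tail has the same order because `β > 0`. -/
theorem lyapunov_le {ν : Measure ℝ} [IsProbabilityMeasure ν] (hν : ν (Set.Iio 0) = 0)
    {β b : ℝ} {L : ℝ → ℝ} (hβ : 0 < β) (hb : β < b) (hL : SlowlyVarying L)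
    (hF : ∀ x, 0 < x → ν.real (Set.Ioi x) = x ^ (-2 - β) * L x) :
    ∃ X C : ℝ, 0 < X ∧ 0 < C ∧ ∀ x, X ≤ x →
      lyapunov ν b x ≤ ENNReal.ofReal (C * (x ^ 2 * ν.real (Set.Ioi x))) := by
  obtain ⟨X, C, hX, hC, h⟩ := lintegral_sq_Ioi_le hβ hL hF
  obtain ⟨X', r₁, r₂, hX', -, -, -, hrb, h'⟩ := tail_dyadic hβ hb hL hF
  have hb0 : 0 < b := hβ.trans hb
  obtain ⟨K, hK, hK'⟩ := lintegral_Ioc_rpow_le hb0 hX' hrb (tail_pos hL hF)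
    (fun x hx => (h' x hx).2)
  refine ⟨max X X', K + C, by positivity, by positivity, fun x hx => ?_⟩
  have hx1 := (le_max_left _ _).trans hx
  have hx2 := (le_max_right _ _).trans hx
  have hx0 : 0 < x := hX.trans_le hx1
  have hFx := tail_pos hL hF x
  have hcov : (Set.univ : Set ℝ) ⊆ Set.Iio 0 ∪ ({0} ∪ (Set.Ioc 0 x ∪ Set.Ioi x)) := by
    intro s _
    rcases lt_trichotomy s 0 with h | h | h
    · exact Or.inl h
    · exact Or.inr (Or.inl h)
    · rcases le_or_gt s x with h' | h'
      · exact Or.inr (Or.inr (Or.inl ⟨h, h'⟩))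
      · exact Or.inr (Or.inr (Or.inr h'))
  unfold lyapunov
  rw [← setLIntegral_univ]
  refine (lintegral_mono_set hcov).trans ((lintegral_union_le _ _ _).trans ?_)
  rw [setLIntegral_measure_zero _ _ hν, zero_add]
  refine (lintegral_union_le _ _ _).trans ?_
  have hz : ∫⁻ s in {0}, ENNReal.ofReal (mixKernel b x s) ∂ν = 0 := by
    rw [lintegral_singleton]
    simp [mixKernel, Real.zero_rpow (show 2 + b ≠ 0 by positivity)]
  rw [hz, zero_add]
  refine (lintegral_union_le _ _ _).trans ?_
  rw [add_mul, ENNReal.ofReal_add (by positivity) (by positivity)]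
  refine add_le_add ?_ ?_
  · have hxb : 0 ≤ x ^ (-b) := by positivity
    calc ∫⁻ s in Set.Ioc 0 x, ENNReal.ofReal (mixKernel b x s) ∂ν
        ≤ ∫⁻ s in Set.Ioc 0 x, ENNReal.ofReal (|s| ^ (2 + b)) * ENNReal.ofReal (x ^ (-b)) ∂ν := by
          refine lintegral_mono fun s => ?_
          rw [← ENNReal.ofReal_mul (by positivity)]
          exact ENNReal.ofReal_le_ofReal (mixKernel_le_rpow hb0 hx0 s)
      _ = (∫⁻ s in Set.Ioc 0 x, ENNReal.ofReal (|s| ^ (2 + b)) ∂ν) * ENNReal.ofReal (x ^ (-b)) :=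
          lintegral_mul_const' _ _ ENNReal.ofReal_ne_top
      _ ≤ ENNReal.ofReal (K * (x ^ (2 + b) * ν.real (Set.Ioi x))) * ENNReal.ofReal (x ^ (-b)) := by
          gcongr; exact hK' x hx2
      _ = ENNReal.ofReal (K * (x ^ 2 * ν.real (Set.Ioi x))) := by
          rw [← ENNReal.ofReal_mul (by positivity)]
          congr 1
          have : x ^ (2 + b) * x ^ (-b) = x ^ 2 := by
            rw [← Real.rpow_add hx0, ← Real.rpow_natCast]; congr 1; push_cast; ring
          rw [← this]; ring
  · exact (lintegral_mono fun s => ENNReal.ofReal_le_ofReal (mixKernel_le_sq hb0 hx0 s)).trans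
      (h x hx1)

theorem tendsto_lyapunov {ν : Measure ℝ} [IsProbabilityMeasure ν] {b : ℝ} (hb : 0 < b)
    (hsq : ∫⁻ s, ENNReal.ofReal (s ^ 2) ∂ν < ⊤) : Tendsto (lyapunov ν b) atTop (𝓝 0) := by
  have h0 : (0 : ENNReal) = ∫⁻ _, 0 ∂ν := by simp
  rw [h0]
  refine tendsto_lintegral_filter_of_dominated_convergence (fun s => ENNReal.ofReal (s ^ 2))
    (Eventually.of_forall fun x => ?_) ?_ hsq.ne (Eventually.of_forall fun s => ?_)
  · exact ((measurable_mixKernel b).comp (measurable_const.prodMk measurable_id)).ennreal_ofReal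
  · filter_upwards [eventually_gt_atTop 0] with x hx
    exact Eventually.of_forall fun s => ENNReal.ofReal_le_ofReal (mixKernel_le_sq hb hx s)
  · rw [← ENNReal.ofReal_zero]
    refine ENNReal.tendsto_ofReal ?_
    have h1 : Tendsto (fun x : ℝ => |s| ^ (2 + b) * x ^ (-b)) atTop (𝓝 0) := by
      simpa using (tendsto_rpow_neg_atTop hb).const_mul (|s| ^ (2 + b))
    refine tendsto_of_tendsto_of_tendsto_of_le_of_le' tendsto_const_nhds h1
      (Eventually.of_forall fun x => mixKernel_nonneg b x s) ?_
    filter_upwards [eventually_gt_atTop 0] with x hx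
    exact mixKernel_le_rpow hb hx s

theorem lyapunov_pos {ν : Measure ℝ} {b x : ℝ} (hx : 0 < x) (hν : 0 < ν (Set.Ioi 0)) :
    0 < lyapunov ν b x := by
  unfold lyapunov
  rw [lintegral_pos_iff_support]
  · refine hν.trans_le (measure_mono fun s hs => ?_)
    have hs : 0 < s := hs
    simp only [Function.mem_support, ne_eq, ENNReal.ofReal_eq_zero, not_le, mixKernel]
    positivity
  · exact ((measurable_mixKernel b).comp (measurable_const.prodMk measurable_id)).ennreal_ofReal

/-! ### Growth of the reserve between claims -/

section Interval

variable {v R : ℝ → ℝ} {a a' z : ℝ}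

/-- A nondecreasing path ending below `y + c σ` would have stayed in `[y, y + c σ]`, where the rate
is at least `c`, and so would have gained at least `c σ`. No continuity of `v` or comparison theorem
for differential equations is involved. -/
theorem reserve_growth_lower (hv : ∀ y, 0 ≤ v y) (haa : a ≤ a')
    (hint : IntervalIntegrable (fun s => v (R s)) volume a a')
    (hR : ∀ t ∈ Set.Ico a a', R t = z + ∫ s in a..t, v (R s))
    {y c σ : ℝ} (hc : 0 ≤ c) (hσ : σ ≤ a' - a) (hy : y ≤ z)
    (hvc : ∀ r ∈ Set.Icc y (y + c * σ), c ≤ v r) :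
    y + c * σ ≤ z + ∫ s in a..a', v (R s) := by
  by_contra! hlt
  have hb : ∀ t ∈ Set.Ioo a a', c ≤ v (R t) := by
    intro t ht
    rw [hR t ⟨ht.1.le, ht.2⟩]
    refine hvc _ ⟨?_, ?_⟩
    · have := intervalIntegral.integral_nonneg (μ := volume) ht.1.le (fun s _ => hv (R s))
      linarith
    · have := intervalIntegral.integral_mono_interval (le_refl a) ht.1.le ht.2.le
        (Eventually.of_forall fun s => hv (R s)) hint
      linarith
  have := intervalIntegral.integral_mono_on_of_le_Ioo haa (intervalIntegrable_const) hint hb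
  rw [intervalIntegral.integral_const, smul_eq_mul] at this
  nlinarith

/-- The rate is controlled only above `x`, so the estimate starts when the path is at or above `x`:
at once if `z ≥ x`, otherwise at a crossing given by the intermediate value theorem. This is the
origin of `max z x`. -/
theorem reserve_growth_upper (hv : ∀ y, 0 ≤ v y) (haa : a ≤ a')
    (hint : IntervalIntegrable (fun s => v (R s)) volume a a')
    (hR : ∀ t ∈ Set.Ico a a', R t = z + ∫ s in a..t, v (R s))
    {x c : ℝ} (hc : 0 ≤ c) (hvc : ∀ r, x ≤ r → v r ≤ c) :
    z + ∫ s in a..a', v (R s) ≤ max z x + c * (a' - a) := by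
  rcases le_total (z + ∫ s in a..a', v (R s)) x with hle | hge
  · exact (hle.trans (le_max_right _ _)).trans
      (le_add_of_nonneg_right (mul_nonneg hc (by linarith)))
  obtain ⟨t₀, ht₀, h1, h2⟩ : ∃ t₀ ∈ Set.Icc a a', x ≤ z + (∫ s in a..t₀, v (R s)) ∧
      z + (∫ s in a..t₀, v (R s)) ≤ max z x := by
    rcases le_total x z with hxz | hzx
    · exact ⟨a, ⟨le_rfl, haa⟩, by simpa using hxz, by simp⟩
    · have hcont : ContinuousOn (fun t => z + ∫ s in a..t, v (R s)) (Set.Icc a a') := by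
        have := intervalIntegral.continuousOn_primitive_interval' hint Set.left_mem_uIcc
        rw [Set.uIcc_of_le haa] at this
        exact continuousOn_const.add this
      obtain ⟨t₀, ht₀, he⟩ := intermediate_value_Icc haa hcont
        (show x ∈ Set.Icc _ _ from ⟨by simpa using hzx, hge⟩)
      exact ⟨t₀, ht₀, he.ge, he.le.trans (le_max_right _ _)⟩
  have hi1 : IntervalIntegrable (fun s => v (R s)) volume a t₀ := hint.mono_set (by
    rw [Set.uIcc_of_le haa, Set.uIcc_of_le ht₀.1]; exact Set.Icc_subset_Icc_right ht₀.2)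
  have hi2 : IntervalIntegrable (fun s => v (R s)) volume t₀ a' := hint.mono_set (by
    rw [Set.uIcc_of_le haa, Set.uIcc_of_le ht₀.2]; exact Set.Icc_subset_Icc_left ht₀.1)
  have hb : ∀ t ∈ Set.Ioo t₀ a', v (R t) ≤ c := by
    intro t ht
    rw [hR t ⟨ht₀.1.trans ht.1.le, ht.2⟩]
    refine hvc _ (h1.trans ?_)
    have := intervalIntegral.integral_mono_interval (f := fun s => v (R s)) (μ := volume)
      (le_refl a) ht₀.1 ht.1.le (Eventually.of_forall fun s => hv (R s)) (hint.mono_set (by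
        rw [Set.uIcc_of_le haa, Set.uIcc_of_le (ht₀.1.trans ht.1.le)]
        exact Set.Icc_subset_Icc_right ht.2.le))
    linarith
  have := intervalIntegral.integral_mono_on_of_le_Ioo ht₀.2 hi2 intervalIntegrable_const hb
  rw [intervalIntegral.integral_const, smul_eq_mul] at this
  rw [← intervalIntegral.integral_add_adjacent_intervals hi1 hi2]
  have : (a' - t₀) * c ≤ (a' - a) * c := by gcongr; exact ht₀.1
  linarith

end Interval

/-! ### The reserve along a trajectory, claim by claim -/

section Path

variable {Ω : Type*} {τ ξ : ℕ → Ω → ℝ} {ω : Ω}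

theorem claimEpoch_succ (τ : ℕ → Ω → ℝ) (n : ℕ) (ω : Ω) :
    claimEpoch τ (n + 1) ω = claimEpoch τ n ω + τ n ω := Finset.sum_range_succ _ _

theorem claimEpoch_monotone (hτ : ∀ n, 0 ≤ τ n ω) : Monotone fun n => claimEpoch τ n ω :=
  monotone_nat_of_le_succ fun n => by rw [claimEpoch_succ]; linarith [hτ n]

theorem claimEpoch_nonneg (hτ : ∀ n, 0 ≤ τ n ω) (n : ℕ) : 0 ≤ claimEpoch τ n ω :=
  Finset.sum_nonneg fun i _ => hτ i

theorem claimCount_eq (hτ : ∀ n, 0 ≤ τ n ω) {n : ℕ} {t : ℝ} (h1 : claimEpoch τ n ω ≤ t)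
    (h2 : t < claimEpoch τ (n + 1) ω) : claimCount τ t ω = n := by
  have hmax : IsGreatest {n : ℕ | claimEpoch τ n ω ≤ t} n := by
    refine ⟨h1, fun m hm => ?_⟩
    by_contra! hlt
    exact absurd (h2.trans_le (claimEpoch_monotone hτ hlt)) (not_lt.2 hm)
  exact hmax.csSup_eq

theorem exists_claimEpoch (hT : Tendsto (fun n => claimEpoch τ n ω) atTop atTop) {t : ℝ}
    (ht : 0 ≤ t) : ∃ n, claimEpoch τ n ω ≤ t ∧ t < claimEpoch τ (n + 1) ω := by
  classical
  have hex : ∃ n, t < claimEpoch τ n ω := (hT.eventually_gt_atTop t).exists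
  have hpos : Nat.find hex ≠ 0 := by
    intro h
    have := Nat.find_spec hex
    rw [h] at this
    simp [claimEpoch] at this
    linarith
  obtain ⟨m, hm⟩ := Nat.exists_eq_succ_of_ne_zero hpos
  refine ⟨m, not_lt.1 (Nat.find_min hex (by omega)), ?_⟩
  have := Nat.find_spec hex
  rwa [hm] at this

/-- The reserve just after the `n`-th claim. -/
noncomputable def postClaim (v : ℝ → ℝ) (τ ξ : ℕ → Ω → ℝ) (x : ℝ) (R : ℝ → Ω → ℝ) (n : ℕ)
    (ω : Ω) : ℝ :=
  x + (∫ s in (0 : ℝ)..claimEpoch τ n ω, v (R s ω)) - ∑ j ∈ Finset.range n, ξ j ω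

/-- The reserve equation along one trajectory. -/
def ReservePath (v : ℝ → ℝ) (τ ξ : ℕ → Ω → ℝ) (x : ℝ) (R : ℝ → Ω → ℝ) (ω : Ω) : Prop :=
  ∀ t : ℝ, 0 ≤ t →
    IntervalIntegrable (fun s => v (R s ω)) volume 0 t ∧
    R t ω = x + (∫ s in (0 : ℝ)..t, v (R s ω)) - ∑ j ∈ Finset.range (claimCount τ t ω), ξ j ω

variable {v : ℝ → ℝ} {x : ℝ} {R : ℝ → Ω → ℝ}

theorem postClaim_zero : postClaim v τ ξ x R 0 ω = x := by simp [postClaim, claimEpoch]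

theorem ReservePath.intervalIntegrable (h : ReservePath v τ ξ x R ω) {a b : ℝ} (ha : 0 ≤ a)
    (hb : 0 ≤ b) : IntervalIntegrable (fun s => v (R s ω)) volume a b :=
  (h a ha).1.symm.trans (h b hb).1

theorem ReservePath.eq_postClaim_add (h : ReservePath v τ ξ x R ω) (hτ : ∀ n, 0 ≤ τ n ω) (n : ℕ)
    {t : ℝ} (ht : t ∈ Set.Ico (claimEpoch τ n ω) (claimEpoch τ (n + 1) ω)) :
    R t ω = postClaim v τ ξ x R n ω + ∫ s in claimEpoch τ n ω..t, v (R s ω) := by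
  have hT := claimEpoch_nonneg hτ n
  have ht0 := hT.trans ht.1
  rw [(h t ht0).2, claimCount_eq hτ ht.1 ht.2, postClaim,
    ← intervalIntegral.integral_add_adjacent_intervals (h _ hT).1 (h.intervalIntegrable hT ht0)]
  ring

theorem ReservePath.postClaim_succ (h : ReservePath v τ ξ x R ω) (hτ : ∀ n, 0 ≤ τ n ω) (n : ℕ) :
    postClaim v τ ξ x R (n + 1) ω = postClaim v τ ξ x R n ω +
      (∫ s in claimEpoch τ n ω..claimEpoch τ (n + 1) ω, v (R s ω)) - ξ n ω := by
  have hT := claimEpoch_nonneg hτ n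
  have hT' := claimEpoch_nonneg hτ (n + 1)
  rw [postClaim, postClaim,
    ← intervalIntegral.integral_add_adjacent_intervals (h _ hT).1 (h.intervalIntegrable hT hT'),
    Finset.sum_range_succ]
  ring

theorem ReservePath.postClaim_succ_ge (h : ReservePath v τ ξ x R ω) (hτ : ∀ n, 0 ≤ τ n ω)
    (hv : ∀ y, 0 ≤ v y) (n : ℕ) {y c σ : ℝ} (hc : 0 ≤ c) (hσ : σ ≤ τ n ω)
    (hy : y ≤ postClaim v τ ξ x R n ω) (hvc : ∀ r ∈ Set.Icc y (y + c * σ), c ≤ v r) :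
    y + c * σ - ξ n ω ≤ postClaim v τ ξ x R (n + 1) ω := by
  rw [h.postClaim_succ hτ]
  have := reserve_growth_lower (R := fun s => R s ω) hv (claimEpoch_monotone hτ n.le_succ)
    (h.intervalIntegrable (claimEpoch_nonneg hτ n) (claimEpoch_nonneg hτ (n + 1)))
    (fun t ht => h.eq_postClaim_add hτ n ht) hc
    (show σ ≤ claimEpoch τ (n + 1) ω - claimEpoch τ n ω by rw [claimEpoch_succ]; linarith) hy hvc
  linarith

theorem ReservePath.postClaim_succ_le (h : ReservePath v τ ξ x R ω) (hτ : ∀ n, 0 ≤ τ n ω)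
    (hv : ∀ y, 0 ≤ v y) (n : ℕ) {y c : ℝ} (hc : 0 ≤ c) (hvc : ∀ r, y ≤ r → v r ≤ c) :
    postClaim v τ ξ x R (n + 1) ω ≤ max (postClaim v τ ξ x R n ω) y + c * τ n ω - ξ n ω := by
  rw [h.postClaim_succ hτ]
  have := reserve_growth_upper (R := fun s => R s ω) hv (claimEpoch_monotone hτ n.le_succ)
    (h.intervalIntegrable (claimEpoch_nonneg hτ n) (claimEpoch_nonneg hτ (n + 1)))
    (fun t ht => h.eq_postClaim_add hτ n ht) hc hvc
  rw [show claimEpoch τ (n + 1) ω - claimEpoch τ n ω = τ n ω by rw [claimEpoch_succ]; ring] at this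
  linarith

/-- Ruin does not occur if the reserve after each claim is nonnegative. -/
theorem ReservePath.nonneg (h : ReservePath v τ ξ x R ω) (hτ : ∀ n, 0 ≤ τ n ω)
    (hT : Tendsto (fun n => claimEpoch τ n ω) atTop atTop) (hv : ∀ y, 0 ≤ v y)
    (hZ : ∀ n, 0 ≤ postClaim v τ ξ x R n ω) {t : ℝ} (ht : 0 ≤ t) : 0 ≤ R t ω := by
  obtain ⟨n, h1, h2⟩ := exists_claimEpoch hT ht
  rw [h.eq_postClaim_add hτ n ⟨h1, h2⟩]
  exact add_nonneg (hZ n) (intervalIntegral.integral_nonneg h1 fun s _ => hv _)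

/-- Ruin occurs if the reserve after some claim is negative. -/
theorem ReservePath.exists_neg (h : ReservePath v τ ξ x R ω) (hτ : ∀ n, 0 ≤ τ n ω)
    (hξ : ∀ n, 0 ≤ ξ n ω) (hT : Tendsto (fun n => claimEpoch τ n ω) atTop atTop) {n : ℕ}
    (hZ : postClaim v τ ξ x R n ω < 0) : ∃ t, 0 ≤ t ∧ R t ω < 0 := by
  refine ⟨claimEpoch τ n ω, claimEpoch_nonneg hτ n, ?_⟩
  obtain ⟨m, h1, h2⟩ := exists_claimEpoch hT (claimEpoch_nonneg hτ n)
  -- Vanishing inter-claim times may put several claims at one epoch, so `m` can exceed `n`; the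
  -- additional claims only lower the reserve.
  have hnm : n ≤ m := by
    by_contra! hlt
    exact absurd h2 (not_lt.2 (claimEpoch_monotone hτ hlt))
  rw [(h _ (claimEpoch_nonneg hτ n)).2, claimCount_eq hτ h1 h2]
  refine lt_of_le_of_lt ?_ hZ
  have := Finset.sum_le_sum_of_subset_of_nonneg (f := fun j => ξ j ω)
    (Finset.range_mono hnm) (fun i _ _ => hξ i)
  simp only [postClaim]
  linarith

/-- Upper bound on the reserve in terms of the free random walk. -/
theorem ReservePath.postClaim_le_walk (h : ReservePath v τ ξ x R ω) (hτ : ∀ n, 0 ≤ τ n ω)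
    (hv : ∀ y, 0 ≤ v y) {c m : ℝ} (hc : 0 ≤ c) (hm : 0 ≤ m) (hvc : ∀ r, x ≤ r → v r ≤ c) {k : ℕ}
    (hW : ∀ i < k, -m ≤ ∑ j ∈ Finset.range i, (c * τ j ω - ξ j ω)) :
    postClaim v τ ξ x R k ω ≤ x + m + ∑ j ∈ Finset.range k, (c * τ j ω - ξ j ω) := by
  induction k with
  | zero => simpa [postClaim_zero] using hm
  | succ k ih =>
    have ih := ih fun i hi => hW i (by omega)
    have h1 := h.postClaim_succ_le hτ hv k hc hvc
    -- The walk never falls below `-m`, so the level `x` itself is below the claimed bound and the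
    -- maximum costs nothing.
    have h2 : max (postClaim v τ ξ x R k ω) x ≤
        x + m + ∑ j ∈ Finset.range k, (c * τ j ω - ξ j ω) :=
      max_le ih (by linarith [hW k (by omega)])
    rw [Finset.sum_range_succ]
    linarith

end Path

/-! ### Independence of the past and the next claim -/

section Independence

variable {Ω : Type*} {τ ξ : ℕ → Ω → ℝ}

/-- The σ-algebra generated by the inter-claim times and claim sizes with index in `S`. -/
abbrev inputSigma (τ ξ : ℕ → Ω → ℝ) (S : Set (ℕ ⊕ ℕ)) : MeasurableSpace Ω :=
  ⨆ i ∈ S, MeasurableSpace.comap (Sum.elim τ ξ i) inferInstance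

/-- The indices of the inputs used by the first `n` claims. -/
def pastInputs (n : ℕ) : Set (ℕ ⊕ ℕ) := {i | Sum.elim id id i < n}

theorem inputSigma_mono {S T : Set (ℕ ⊕ ℕ)} (h : S ⊆ T) : inputSigma τ ξ S ≤ inputSigma τ ξ T :=
  biSup_mono h

theorem pastInputs_mono {m n : ℕ} (h : m ≤ n) : pastInputs m ⊆ pastInputs n :=
  fun _ hi => lt_of_lt_of_le hi h

theorem comap_le_inputSigma {S : Set (ℕ ⊕ ℕ)} {i : ℕ ⊕ ℕ} (h : i ∈ S) :
    MeasurableSpace.comap (Sum.elim τ ξ i) inferInstance ≤ inputSigma τ ξ S :=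
  le_biSup (fun i => MeasurableSpace.comap (Sum.elim τ ξ i) inferInstance) h

theorem measurable_inputSigma_left {S : Set (ℕ ⊕ ℕ)} {n : ℕ} (h : Sum.inl n ∈ S) :
    Measurable[inputSigma τ ξ S] (τ n) :=
  measurable_iff_comap_le.2 (comap_le_inputSigma (τ := τ) (ξ := ξ) h)

theorem measurable_inputSigma_right {S : Set (ℕ ⊕ ℕ)} {n : ℕ} (h : Sum.inr n ∈ S) :
    Measurable[inputSigma τ ξ S] (ξ n) :=
  measurable_iff_comap_le.2 (comap_le_inputSigma (τ := τ) (ξ := ξ) h)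

variable [mΩ : MeasurableSpace Ω] {μ : Measure Ω}

theorem inputSigma_le (hτ : ∀ n, Measurable (τ n)) (hξ : ∀ n, Measurable (ξ n))
    (S : Set (ℕ ⊕ ℕ)) : inputSigma τ ξ S ≤ mΩ := by
  refine iSup₂_le fun i _ => measurable_iff_comap_le.1 ?_
  cases i with
  | inl n => exact hτ n
  | inr n => exact hξ n

theorem indepFun_of_inputSigma (hτ : ∀ n, Measurable (τ n)) (hξ : ∀ n, Measurable (ξ n))
    (hindep : iIndepFun (Sum.elim τ ξ) μ) {S T : Set (ℕ ⊕ ℕ)} (hST : Disjoint S T)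
    {α β : Type*} [MeasurableSpace α] [MeasurableSpace β] {X : Ω → α} {Y : Ω → β}
    (hX : Measurable[inputSigma τ ξ S] X) (hY : Measurable[inputSigma τ ξ T] Y) :
    IndepFun X Y μ := by
  rw [IndepFun_iff_Indep]
  have h : Indep (inputSigma τ ξ S) (inputSigma τ ξ T) μ := by
    refine indep_iSup_of_disjoint (fun i => measurable_iff_comap_le.1 ?_) hindep hST
    cases i with
    | inl n => exact hτ n
    | inr n => exact hξ n
  exact indep_of_indep_of_le_left (indep_of_indep_of_le_right h (measurable_iff_comap_le.1 hY))
    (measurable_iff_comap_le.1 hX)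

/-- Functions of the past are independent of the next pair of inputs. -/
theorem indepFun_past (hτ : ∀ n, Measurable (τ n)) (hξ : ∀ n, Measurable (ξ n))
    (hindep : iIndepFun (Sum.elim τ ξ) μ) {n : ℕ} {α : Type*} [MeasurableSpace α] {X : Ω → α}
    (hX : Measurable[inputSigma τ ξ (pastInputs n)] X) :
    IndepFun X (fun ω => (τ n ω, ξ n ω)) μ := by
  refine indepFun_of_inputSigma hτ hξ hindep (S := pastInputs n) (T := {Sum.inl n, Sum.inr n})
    ?_ hX ?_
  · rw [Set.disjoint_left]
    rintro i hi (rfl | rfl) <;> simp [pastInputs] at hi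
  · exact (measurable_inputSigma_left (by simp)).prodMk (measurable_inputSigma_right (by simp))

theorem map_pair_eq [IsProbabilityMeasure μ] (hτ : ∀ n, Measurable (τ n))
    (hξ : ∀ n, Measurable (ξ n)) (hindep : iIndepFun (Sum.elim τ ξ) μ)
    (hτ_ident : ∀ n, IdentDistrib (τ n) (τ 0) μ μ) (hξ_ident : ∀ n, IdentDistrib (ξ n) (ξ 0) μ μ)
    (n : ℕ) : μ.map (fun ω => (τ n ω, ξ n ω)) = μ.map (fun ω => (τ 0 ω, ξ 0 ω)) := by
  have h : ∀ n, μ.map (fun ω => (τ n ω, ξ n ω)) = (μ.map (τ n)).prod (μ.map (ξ n)) := fun n =>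
    (indepFun_iff_map_prod_eq_prod_map_map (hτ n).aemeasurable (hξ n).aemeasurable).1
      (hindep.indepFun (show Sum.inl n ≠ Sum.inr n by simp))
  rw [h n, h 0, (hτ_ident n).map_eq, (hξ_ident n).map_eq]

/-- Conditioning on the past: integrate out the next pair of inputs first. -/
theorem lintegral_past_pair [IsProbabilityMeasure μ] (hτ : ∀ n, Measurable (τ n))
    (hξ : ∀ n, Measurable (ξ n)) (hindep : iIndepFun (Sum.elim τ ξ) μ)
    (hτ_ident : ∀ n, IdentDistrib (τ n) (τ 0) μ μ) (hξ_ident : ∀ n, IdentDistrib (ξ n) (ξ 0) μ μ)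
    {n : ℕ} {X : Ω → ℝ} (hX : Measurable[inputSigma τ ξ (pastInputs n)] X)
    {G : ℝ → ℝ × ℝ → ENNReal} (hG : Measurable (Function.uncurry G)) :
    ∫⁻ ω, G (X ω) (τ n ω, ξ n ω) ∂μ = ∫⁻ ω, ∫⁻ ω', G (X ω) (τ 0 ω', ξ 0 ω') ∂μ ∂μ := by
  have hXm : Measurable X := hX.mono (inputSigma_le hτ hξ _) le_rfl
  have hp : ∀ n, Measurable fun ω => (τ n ω, ξ n ω) := fun n => (hτ n).prodMk (hξ n)
  calc ∫⁻ ω, G (X ω) (τ n ω, ξ n ω) ∂μ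
      = ∫⁻ z, Function.uncurry G z ∂(μ.map fun ω => (X ω, (τ n ω, ξ n ω))) :=
        (lintegral_map hG (hXm.prodMk (hp n))).symm
    _ = ∫⁻ z, Function.uncurry G z ∂((μ.map X).prod (μ.map fun ω => (τ 0 ω, ξ 0 ω))) := by
        rw [(indepFun_iff_map_prod_eq_prod_map_map hXm.aemeasurable (hp n).aemeasurable).1
          (indepFun_past hτ hξ hindep hX), map_pair_eq hτ hξ hindep hτ_ident hξ_ident]
    _ = ∫⁻ x, ∫⁻ y, G x y ∂(μ.map fun ω => (τ 0 ω, ξ 0 ω)) ∂(μ.map X) :=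
        lintegral_prod _ hG.aemeasurable
    _ = ∫⁻ ω, ∫⁻ y, G (X ω) y ∂(μ.map fun ω => (τ 0 ω, ξ 0 ω)) ∂μ :=
        lintegral_map hG.lintegral_prod_right' hXm
    _ = ∫⁻ ω, ∫⁻ ω', G (X ω) (τ 0 ω', ξ 0 ω') ∂μ ∂μ := by
        refine lintegral_congr fun ω => ?_
        exact lintegral_map (hG.comp (measurable_const.prodMk measurable_id)) (hp 0)

theorem ae_tendsto_claimEpoch [IsProbabilityMeasure μ] (hindep : iIndepFun (Sum.elim τ ξ) μ)
    (hτ_ident : ∀ n, IdentDistrib (τ n) (τ 0) μ μ) (hτ_mean : 0 < ∫ ω, τ 0 ω ∂μ) :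
    ∀ᵐ ω ∂μ, Tendsto (fun n => claimEpoch τ n ω) atTop atTop := by
  -- The integral of a nonintegrable function is `0` by convention, so a positive mean forces
  -- integrability.
  have hint : Integrable (τ 0) μ := by
    by_contra h
    rw [integral_undef h] at hτ_mean
    exact lt_irrefl _ hτ_mean
  filter_upwards [strong_law_ae_real τ hint
    (fun i j hij => hindep.indepFun (show Sum.inl i ≠ Sum.inl j by simpa using hij)) hτ_ident]
    with ω hω
  have := hω.pos_mul_atTop hτ_mean tendsto_natCast_atTop_atTop
  refine this.congr' ?_
  filter_upwards [eventually_gt_atTop 0] with n hn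
  rw [div_mul_cancel₀ _ (by positivity)]
  rfl

end Independence

/-! ### Second moments of the stopped walk -/

section StoppedWalk

variable {Ω : Type*} {τ ξ : ℕ → Ω → ℝ}

/-- The random walk with increments `c τ - ξ`, stopped when it leaves `[-a, a]`. -/
noncomputable def stoppedWalk (τ ξ : ℕ → Ω → ℝ) (c a : ℝ) : ℕ → Ω → ℝ
  | 0, _ => 0
  | n + 1, ω => stoppedWalk τ ξ c a n ω +
      if |stoppedWalk τ ξ c a n ω| ≤ a then c * τ n ω - ξ n ω else 0

theorem measurable_stoppedWalk (c a : ℝ) (n : ℕ) :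
    Measurable[inputSigma τ ξ (pastInputs n)] (stoppedWalk τ ξ c a n) := by
  induction n with
  | zero => exact @measurable_const _ _ _ (_) _
  | succ n ih =>
    have h1 := ih.mono (inputSigma_mono (pastInputs_mono n.le_succ)) le_rfl
    have h2 : Measurable[inputSigma τ ξ (pastInputs (n + 1))] (τ n) :=
      measurable_inputSigma_left (by simp [pastInputs])
    have h3 : Measurable[inputSigma τ ξ (pastInputs (n + 1))] (ξ n) :=
      measurable_inputSigma_right (by simp [pastInputs])
    refine h1.add (Measurable.ite ?_ ((h2.const_mul c).sub h3) measurable_const)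
    exact (continuous_abs.measurable.comp h1) measurableSet_Iic

/-- Once outside `[-a, a]` the walk is frozen there, so being inside at time `n` means it never
left. A moment bound at one time thus controls the whole past, with no maximal inequality. -/
theorem stoppedWalk_eq {c a : ℝ} {n : ℕ} {ω : Ω} (h : |stoppedWalk τ ξ c a n ω| ≤ a) :
    ∀ i ≤ n, stoppedWalk τ ξ c a i ω = ∑ j ∈ Finset.range i, (c * τ j ω - ξ j ω) ∧
      |stoppedWalk τ ξ c a i ω| ≤ a := by
  have hback : ∀ i ≤ n, |stoppedWalk τ ξ c a i ω| ≤ a := by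
    intro i hi
    induction hi using Nat.decreasingInduction with
    | self => exact h
    | of_succ k hk ih =>
      by_contra hgt
      rw [stoppedWalk, if_neg hgt, add_zero] at ih
      exact hgt ih
  intro i hi
  refine ⟨?_, hback i hi⟩
  induction i with
  | zero => simp [stoppedWalk]
  | succ i ih =>
    rw [stoppedWalk, if_pos (hback i (by omega)), ih (by omega), Finset.sum_range_succ]

variable [mΩ : MeasurableSpace Ω] {μ : Measure Ω}

/-- The position times the indicator of being inside `[-a, a]` depends on the past, and the next
increment is centred and independent of it. The cross term vanishes, and each step adds at most one
increment variance. -/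
theorem stoppedWalk_second_moment [IsProbabilityMeasure μ] (hτ : ∀ n, Measurable (τ n))
    (hξ : ∀ n, Measurable (ξ n)) (hindep : iIndepFun (Sum.elim τ ξ) μ)
    (hτ_ident : ∀ n, IdentDistrib (τ n) (τ 0) μ μ) (hξ_ident : ∀ n, IdentDistrib (ξ n) (ξ 0) μ μ)
    (hτ2 : MemLp (τ 0) 2 μ) (hξ2 : MemLp (ξ 0) 2 μ) {c : ℝ}
    (hmean : ∫ ω, (c * τ 0 ω - ξ 0 ω) ∂μ = 0) (a : ℝ) (n : ℕ) :
    MemLp (stoppedWalk τ ξ c a n) 2 μ ∧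
      ∫ ω, stoppedWalk τ ξ c a n ω ^ 2 ∂μ ≤ n * ∫ ω, (c * τ 0 ω - ξ 0 ω) ^ 2 ∂μ := by
  have hp : ∀ n, Measurable fun ω => (τ n ω, ξ n ω) := fun n => (hτ n).prodMk (hξ n)
  have hid : ∀ n, IdentDistrib (fun ω => c * τ n ω - ξ n ω) (fun ω => c * τ 0 ω - ξ 0 ω) μ μ := by
    intro n
    have h : IdentDistrib (fun ω => (τ n ω, ξ n ω)) (fun ω => (τ 0 ω, ξ 0 ω)) μ μ :=
      ⟨(hp n).aemeasurable, (hp 0).aemeasurable,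
        map_pair_eq hτ hξ hindep hτ_ident hξ_ident n⟩
    exact h.comp (u := fun p : ℝ × ℝ => c * p.1 - p.2) (by fun_prop)
  have hD0 : MemLp (fun ω => c * τ 0 ω - ξ 0 ω) 2 μ := (hτ2.const_mul c).sub hξ2
  have hD : ∀ n, MemLp (fun ω => c * τ n ω - ξ n ω) 2 μ := fun n => (hid n).memLp_iff.2 hD0
  induction n with
  | zero => exact ⟨by simp [stoppedWalk], by simp [stoppedWalk]⟩
  | succ n ih =>
    obtain ⟨ih1, ih2⟩ := ih
    set S := stoppedWalk τ ξ c a n with hS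
    set D : Ω → ℝ := fun ω => c * τ n ω - ξ n ω with hDn
    set I : Ω → ℝ := fun ω => if |S ω| ≤ a then 1 else 0 with hI
    have hSm' := measurable_stoppedWalk (τ := τ) (ξ := ξ) c a n
    have hSm : Measurable S := hSm'.mono (inputSigma_le hτ hξ _) le_rfl
    have hφ : Measurable fun s : ℝ => if |s| ≤ a then (1 : ℝ) else 0 :=
      Measurable.ite (continuous_abs.measurable measurableSet_Iic) measurable_const measurable_const
    have hIm : Measurable I := hφ.comp hSm
    have hI1 : ∀ ω, I ω ^ 2 ≤ 1 ∧ 0 ≤ I ω ∧ I ω ≤ 1 := fun ω => by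
      simp only [hI]; split_ifs <;> simp
    have heq : stoppedWalk τ ξ c a (n + 1) = fun ω => S ω + I ω * D ω := by
      funext ω
      simp only [stoppedWalk, hI, hS, hDn]
      split_ifs <;> simp
    have hID : MemLp (fun ω => I ω * D ω) 2 μ := by
      refine (hD n).mono (hIm.aestronglyMeasurable.mul (hD n).1) (Eventually.of_forall fun ω => ?_)
      rw [norm_mul]
      refine mul_le_of_le_one_left (norm_nonneg _) ?_
      rw [Real.norm_eq_abs, abs_of_nonneg (hI1 ω).2.1]
      exact (hI1 ω).2.2
    have hSI : MemLp (fun ω => S ω * I ω) 2 μ := by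
      refine ih1.mono (hSm.mul hIm).aestronglyMeasurable (Eventually.of_forall fun ω => ?_)
      rw [norm_mul]
      refine mul_le_of_le_one_right (norm_nonneg _) ?_
      rw [Real.norm_eq_abs, abs_of_nonneg (hI1 ω).2.1]
      exact (hI1 ω).2.2
    have hind : IndepFun (fun ω => S ω * I ω) D μ :=
      (indepFun_past hτ hξ hindep hSm').comp (φ := fun s => s * if |s| ≤ a then (1 : ℝ) else 0)
        (ψ := fun p : ℝ × ℝ => c * p.1 - p.2) (measurable_id.mul hφ) (by fun_prop)
    have hcross : ∫ ω, (S ω * I ω) * D ω ∂μ = 0 := by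
      rw [hind.integral_fun_mul_eq_mul_integral hSI.1 (hD n).1, (hid n).integral_eq, hmean,
        mul_zero]
    refine ⟨heq ▸ ih1.add hID, ?_⟩
    have hi1 : Integrable (fun ω => S ω ^ 2) μ := ih1.integrable_sq
    have hi2 : Integrable (fun ω => 2 * ((S ω * I ω) * D ω)) μ :=
      (hSI.integrable_mul (hD n)).const_mul 2
    have hi3 : Integrable (fun ω => (I ω * D ω) ^ 2) μ := hID.integrable_sq
    have h3 : ∫ ω, (I ω * D ω) ^ 2 ∂μ ≤ ∫ ω, (c * τ 0 ω - ξ 0 ω) ^ 2 ∂μ := by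
      refine le_of_le_of_eq (integral_mono hi3 (hD n).integrable_sq fun ω => ?_)
        ((hid n).comp (u := fun y : ℝ => y ^ 2) (by fun_prop)).integral_eq
      simp only [mul_pow]
      exact mul_le_of_le_one_left (sq_nonneg _) (hI1 ω).1
    calc ∫ ω, stoppedWalk τ ξ c a (n + 1) ω ^ 2 ∂μ
        = ∫ ω, (S ω ^ 2 + 2 * ((S ω * I ω) * D ω) + (I ω * D ω) ^ 2) ∂μ := by
          rw [heq]; congr 1; funext ω; ring
      _ = ∫ ω, S ω ^ 2 ∂μ + 2 * ∫ ω, (S ω * I ω) * D ω ∂μ + ∫ ω, (I ω * D ω) ^ 2 ∂μ := by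
          rw [integral_add (f := fun ω => S ω ^ 2 + 2 * ((S ω * I ω) * D ω)) (hi1.add hi2) hi3,
            integral_add hi1 hi2, integral_const_mul]
      _ ≤ ((n + 1 : ℕ) : ℝ) * ∫ ω, (c * τ 0 ω - ξ 0 ω) ^ 2 ∂μ := by
          rw [hcross]; push_cast; linarith

end StoppedWalk

/-! ### Drift of the truncated step -/

section Drift

variable {Ω : Type*} [MeasurableSpace Ω] {μ : Measure Ω} {X U : Ω → ℝ}

/-- The truncated increment of the comparison chain at level `y`. -/
noncomputable def truncStep (c θ δ y t s : ℝ) : ℝ := (c + θ / y) * min t (δ * y) - s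

theorem measurable_truncStep (c θ δ : ℝ) :
    Measurable fun p : ℝ × ℝ × ℝ => truncStep c θ δ p.1 p.2.1 p.2.2 := by
  unfold truncStep; fun_prop

theorem abs_truncStep_le {c θ δ y t s : ℝ} (hc : 0 ≤ c) (hθ : 0 ≤ θ) (hδ : 0 ≤ δ) (hy : 1 ≤ y)
    (ht : 0 ≤ t) (hs : 0 ≤ s) : |truncStep c θ δ y t s| ≤ (c + θ) * t + s := by
  have h1 : θ / y ≤ θ := div_le_self hθ hy
  have h2 : 0 ≤ min t (δ * y) := le_min ht (by positivity)
  have h3 : (c + θ / y) * min t (δ * y) ≤ (c + θ) * t := by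
    have : 0 ≤ θ / y := by positivity
    exact mul_le_mul (by linarith) (min_le_left _ _) h2 (by linarith)
  have h4 : 0 ≤ (c + θ / y) * min t (δ * y) := by positivity
  unfold truncStep
  rw [abs_le]
  constructor <;> nlinarith

theorem abs_truncStep_le_mul {c θ δ y t s : ℝ} (hc : 0 ≤ c) (hθ : 0 ≤ θ) (hδ : 0 ≤ δ)
    (hy : 1 ≤ y) (ht : 0 ≤ t) (hs : 0 ≤ s) (hsy : s ≤ δ * y) :
    |truncStep c θ δ y t s| ≤ (c + θ + 1) * δ * y := by
  have h1 : θ / y ≤ θ := div_le_self hθ hy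
  have h2 : 0 ≤ min t (δ * y) := le_min ht (by positivity)
  have h3 : (c + θ / y) * min t (δ * y) ≤ (c + θ) * (δ * y) := by
    have : 0 ≤ θ / y := by positivity
    exact mul_le_mul (by linarith) (min_le_right _ _) h2 (by linarith)
  have h4 : 0 ≤ (c + θ / y) * min t (δ * y) := by positivity
  have h5 : 0 ≤ (c + θ) * (δ * y) := by positivity
  unfold truncStep
  rw [abs_le]
  constructor <;> nlinarith

/-- Asymptotic drift of the truncated chain. -/
theorem tendsto_truncated_drift (hXm : Measurable X) (hUm : Measurable U)
    (hX0 : ∀ᵐ ω ∂μ, 0 ≤ X ω) (hU0 : ∀ᵐ ω ∂μ, 0 ≤ U ω) [IsProbabilityMeasure μ]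
    (hX : MemLp X 2 μ) (hU : MemLp U 2 μ) {c θ δ κ : ℝ} (hc : 0 ≤ c) (hθ : 0 ≤ θ) (hδ : 0 < δ)
    (hmean : ∫ ω, (c * X ω - U ω) ∂μ = 0) :
    Tendsto (fun y : ℝ => ∫ ω in {ω | U ω ≤ δ * y}, (y * truncStep c θ δ y (X ω) (U ω) -
      κ * truncStep c θ δ y (X ω) (U ω) ^ 2) ∂μ) atTop
      (𝓝 (θ * (∫ ω, X ω ∂μ) - κ * ∫ ω, (c * X ω - U ω) ^ 2 ∂μ)) := by
  have hX1 : Integrable X μ := hX.integrable one_le_two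
  have hU1 : Integrable U μ := hU.integrable one_le_two
  have hD2 : Integrable (fun ω => (c * X ω - U ω) ^ 2) μ :=
    ((hX.const_mul c).sub hU).integrable_sq
  have hJm : ∀ y, Measurable fun ω => truncStep c θ δ y (X ω) (U ω) := fun y =>
    (measurable_truncStep c θ δ).comp (measurable_const.prodMk (hXm.prodMk hUm))
  have hA : ∀ y, MeasurableSet {ω | U ω ≤ δ * y} := fun y => hUm measurableSet_Iic
  let G : ℝ → Ω → ℝ := fun y ω => y * truncStep c θ δ y (X ω) (U ω) -
      κ * truncStep c θ δ y (X ω) (U ω) ^ 2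
  -- Subtracting `y (c X - U)` over the whole space does not change the integral, by centring, and
  -- removes the part that grows with `y`.
  let H : ℝ → Ω → ℝ := fun y ω =>
    Set.indicator {ω | U ω ≤ δ * y} (G y) ω - y * (c * X ω - U ω)
  -- The term `c X² / δ` pays for truncating `X` at `δ y`; the last bracket uses `y ≤ U / δ` on the
  -- event `U > δ y`.
  let B : Ω → ℝ := fun ω => θ * X ω + c / δ * X ω ^ 2 + |κ| * ((c + θ) * X ω + U ω) ^ 2 +
    (c / δ * (U ω * X ω) + 1 / δ * U ω ^ 2)
  have hBint : Integrable B μ := by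
    refine (((hX1.const_mul θ).add (hX.integrable_sq.const_mul _)).add ?_).add
      (((hU.integrable_mul hX).const_mul _).add (hU.integrable_sq.const_mul _))
    exact ((hX.const_mul (c + θ)).add hU).integrable_sq.const_mul _
  have hG : ∀ y, 1 ≤ y → Integrable (G y) μ := by
    intro y hy
    have hJ : MemLp (fun ω => truncStep c θ δ y (X ω) (U ω)) 2 μ := by
      refine ((hX.const_mul (c + θ)).add hU).mono' (hJm y).aestronglyMeasurable ?_
      filter_upwards [hX0, hU0] with ω h1 h2
      exact abs_truncStep_le hc hθ hδ.le hy h1 h2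
    exact ((hJ.integrable one_le_two).const_mul y).sub (hJ.integrable_sq.const_mul κ)
  have hlim : Tendsto (fun y => ∫ ω, H y ω ∂μ) atTop
      (𝓝 (∫ ω, (θ * X ω - κ * (c * X ω - U ω) ^ 2) ∂μ)) := by
    refine tendsto_integral_filter_of_dominated_convergence B
      (Eventually.of_forall fun y => ?_) ?_ hBint ?_
    · refine Measurable.aestronglyMeasurable ?_
      exact (Measurable.indicator (((hJm y).const_mul y).sub (((hJm y).pow_const 2).const_mul κ))
        (hA y)).sub (((hXm.const_mul c).sub hUm).const_mul y)
    · filter_upwards [eventually_ge_atTop 1] with y hy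
      filter_upwards [hX0, hU0] with ω h1 h2
      have hy0 : 0 < y := by linarith
      have hB1 : 0 ≤ θ * X ω + c / δ * X ω ^ 2 + |κ| * ((c + θ) * X ω + U ω) ^ 2 := by positivity
      have hB2 : 0 ≤ c / δ * (U ω * X ω) + 1 / δ * U ω ^ 2 := by positivity
      by_cases hUy : U ω ≤ δ * y
      · have hJ := abs_truncStep_le (δ := δ) hc hθ hδ.le hy h1 h2
        have hJ2 : truncStep c θ δ y (X ω) (U ω) ^ 2 ≤ ((c + θ) * X ω + U ω) ^ 2 :=
          sq_le_sq' (by linarith [(abs_le.1 hJ).1]) (abs_le.1 hJ).2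
        have hHe : H y ω = θ * min (X ω) (δ * y) - c * (y * (X ω - min (X ω) (δ * y))) -
            κ * truncStep c θ δ y (X ω) (U ω) ^ 2 := by
          simp only [H, G]
          rw [Set.indicator_of_mem (show ω ∈ {ω | U ω ≤ δ * y} from hUy)]
          conv_lhs => rw [sub_right_comm]
          congr 1
          unfold truncStep
          field_simp
          ring
        have hm1 : 0 ≤ min (X ω) (δ * y) := le_min h1 (by positivity)
        have hm2 : min (X ω) (δ * y) ≤ X ω := min_le_left _ _
        have htail : y * (X ω - min (X ω) (δ * y)) ≤ X ω ^ 2 / δ := by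
          rw [le_div_iff₀ hδ]
          rcases le_total (X ω) (δ * y) with h | h
          · rw [min_eq_left h]; nlinarith
          · rw [min_eq_right h]; nlinarith [mul_nonneg h1 (by positivity : 0 ≤ δ * y)]
        have htail0 : 0 ≤ y * (X ω - min (X ω) (δ * y)) := mul_nonneg hy0.le (by linarith)
        rw [hHe, Real.norm_eq_abs]
        calc |θ * min (X ω) (δ * y) - c * (y * (X ω - min (X ω) (δ * y))) -
              κ * truncStep c θ δ y (X ω) (U ω) ^ 2|
            ≤ |θ * min (X ω) (δ * y)| + |c * (y * (X ω - min (X ω) (δ * y)))| +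
              |κ * truncStep c θ δ y (X ω) (U ω) ^ 2| :=
              (abs_sub _ _).trans (add_le_add_left (abs_sub _ _) _)
          _ = θ * min (X ω) (δ * y) + c * (y * (X ω - min (X ω) (δ * y))) +
              |κ| * truncStep c θ δ y (X ω) (U ω) ^ 2 := by
              rw [abs_of_nonneg (by positivity), abs_of_nonneg (by positivity), abs_mul,
                abs_of_nonneg (sq_nonneg (truncStep c θ δ y (X ω) (U ω)))]
          _ ≤ θ * X ω + c * (X ω ^ 2 / δ) + |κ| * ((c + θ) * X ω + U ω) ^ 2 := by gcongr
          _ ≤ B ω := by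
              simp only [B]
              have : c * (X ω ^ 2 / δ) = c / δ * X ω ^ 2 := by ring
              linarith
      · have hHe : H y ω = - (y * (c * X ω - U ω)) := by
          simp only [H]
          rw [Set.indicator_of_notMem (show ω ∉ {ω | U ω ≤ δ * y} from hUy), zero_sub]
        rw [hHe, Real.norm_eq_abs, abs_neg, abs_mul, abs_of_pos hy0]
        have h3 : y ≤ U ω / δ := by rw [le_div_iff₀ hδ]; linarith [not_le.1 hUy]
        have h4 : |c * X ω - U ω| ≤ c * X ω + U ω := by
          rw [abs_le]; constructor <;> nlinarith [mul_nonneg hc h1]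
        calc y * |c * X ω - U ω| ≤ U ω / δ * (c * X ω + U ω) := by gcongr
          _ = c / δ * (U ω * X ω) + 1 / δ * U ω ^ 2 := by ring
          _ ≤ B ω := by simp only [B]; linarith
    · refine Eventually.of_forall fun ω => ?_
      have hl : Tendsto (fun y : ℝ => θ * X ω - κ * ((c + θ / y) * X ω - U ω) ^ 2) atTop
          (𝓝 (θ * X ω - κ * ((c + 0) * X ω - U ω) ^ 2)) := by
        have h0 : Tendsto (fun y : ℝ => θ / y) atTop (𝓝 0) := tendsto_const_nhds.div_atTop tendsto_id
        exact tendsto_const_nhds.sub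
          (((((tendsto_const_nhds.add h0).mul_const _).sub_const _).pow 2).const_mul κ)
      rw [add_zero] at hl
      refine hl.congr' ?_
      filter_upwards [eventually_gt_atTop 0, eventually_ge_atTop (X ω / δ),
        eventually_ge_atTop (U ω / δ)] with y hy0 hy1 hy2
      rw [div_le_iff₀ hδ] at hy1 hy2
      simp only [H, G]
      rw [Set.indicator_of_mem (show ω ∈ {ω | U ω ≤ δ * y} by
        show U ω ≤ δ * y; linarith), truncStep, min_eq_left (by linarith)]
      field_simp
      ring
  rw [integral_sub (hX1.const_mul θ) (hD2.const_mul κ), integral_const_mul,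
    integral_const_mul] at hlim
  refine hlim.congr' ?_
  filter_upwards [eventually_ge_atTop 1] with y hy
  have hDint : Integrable (fun ω => c * X ω - U ω) μ := (hX1.const_mul c).sub hU1
  simp only [H]
  rw [integral_sub ((hG y hy).indicator (hA y)) (hDint.const_mul y), integral_const_mul, hmean, mul_zero, sub_zero, integral_indicator (hA y)]

end Drift

/-! ### Superharmonicity of the Lyapunov function -/

theorem mixKernel_step_le {b ε : ℝ} (hb : 0 < b) (hε : 0 < ε) :
    ∃ η : ℝ, 0 < η ∧ η < 1 ∧ ∀ y s J : ℝ, 0 < y → |J| ≤ η * y →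
      mixKernel b (y + J) s ≤ mixKernel b y s *
        (1 - b / (y ^ 2 + s ^ 2) * (y * J - ((b + 1) / 2 + ε) * J ^ 2)) := by
  obtain ⟨η, h0, h1, h⟩ := kernel_step_le hb hε
  refine ⟨η, h0, h1, fun y s J hy hJ => ?_⟩
  unfold mixKernel
  rw [mul_assoc]
  exact mul_le_mul_of_nonneg_left (h y s J hy hJ) (by positivity)

/-- For `s > y` one has `y² + s² ≤ 2 s²`, and the powers of `s` cancel. This uniform bound turns the
gain of the kernels with `s > y` into a multiple of the tail at `y`, which pays for the large
claims. -/
theorem mixKernel_div_ge {b y s : ℝ} (hb : 0 < b) (hy : 0 < y) (hys : y < s) :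
    2 ^ (-(b / 2) - 1) ≤ mixKernel b y s / (y ^ 2 + s ^ 2) := by
  have hs : 0 < s := hy.trans hys
  have hw : 0 < y ^ 2 + s ^ 2 := by positivity
  unfold mixKernel
  rw [mul_div_assoc, ← Real.rpow_sub_one hw.ne', abs_of_pos hs]
  calc (2 : ℝ) ^ (-(b / 2) - 1) = s ^ (2 + b) * (2 * s ^ 2) ^ (-(b / 2) - 1) := by
        rw [Real.mul_rpow (by norm_num) (by positivity), mul_left_comm]
        have : s ^ (2 + b) * (s ^ 2) ^ (-(b / 2) - 1) = 1 := by
          rw [← Real.rpow_natCast, ← Real.rpow_mul hs.le, ← Real.rpow_add hs]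
          rw [show 2 + b + ((2 : ℕ) : ℝ) * (-(b / 2) - 1) = 0 by push_cast; ring, Real.rpow_zero]
        rw [this, mul_one]
    _ ≤ s ^ (2 + b) * (y ^ 2 + s ^ 2) ^ (-(b / 2) - 1) := by
        refine mul_le_mul_of_nonneg_left ?_ (by positivity)
        exact Real.rpow_le_rpow_of_nonpos hw (by nlinarith) (by linarith)

/-- The truncated Lyapunov function is superharmonic for the comparison chain above a high
level. -/
theorem lyapunov_step_le {Ω : Type*} [MeasurableSpace Ω] {μ : Measure Ω} [IsProbabilityMeasure μ]
    {X U : Ω → ℝ} (hXm : Measurable X) (hUm : Measurable U)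
    (hX0 : ∀ᵐ ω ∂μ, 0 ≤ X ω) (hU0 : ∀ᵐ ω ∂μ, 0 ≤ U ω) (hX : MemLp X 2 μ) (hU : MemLp U 2 μ)
    {b c θ β : ℝ} {L : ℝ → ℝ} (hβ : 0 < β) (hb : β < b) (hL : SlowlyVarying L)
    (hF : ∀ x, 0 < x → (μ.map U).real (Set.Ioi x) = x ^ (-2 - β) * L x)
    (hc : 0 ≤ c) (hθ : 0 ≤ θ) (hmean : ∫ ω, (c * X ω - U ω) ∂μ = 0)
    (hdrift : (b + 1) / 2 * ∫ ω, (c * X ω - U ω) ^ 2 ∂μ < θ * ∫ ω, X ω ∂μ) :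
    ∃ δ₀ : ℝ, 0 < δ₀ ∧ ∀ δ, 0 < δ → δ ≤ δ₀ → ∀ᶠ x₁ in atTop, ∀ y, x₁ < y →
      ∫⁻ ω, lyapunov (μ.map U) b (max (y + truncStep c θ δ y (X ω) (U ω)) x₁) ∂μ ≤
        lyapunov (μ.map U) b y := by
  have hb0 : 0 < b := hβ.trans hb
  set ν := μ.map U with hν
  have : IsProbabilityMeasure ν := Measure.isProbabilityMeasure_map hUm.aemeasurable
  set σ2 := ∫ ω, (c * X ω - U ω) ^ 2 ∂μ with hσ2
  have hσ0 : 0 ≤ σ2 := integral_nonneg fun ω => sq_nonneg _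
  set m := θ * ∫ ω, X ω ∂μ with hm
  set ε := (m - (b + 1) / 2 * σ2) / (2 * (σ2 + 1)) with hε
  have hε0 : 0 < ε := div_pos (by linarith) (by positivity)
  set κ := (b + 1) / 2 + ε with hκ
  have hκ0 : 0 < κ := by positivity
  have hκm : κ * σ2 < m := by
    have h1 : ε * (2 * (σ2 + 1)) = m - (b + 1) / 2 * σ2 := div_mul_cancel₀ _ (by positivity)
    nlinarith
  set c₀ := (m - κ * σ2) / 2 with hc₀
  have hc₀0 : 0 < c₀ := by rw [hc₀]; linarith
  obtain ⟨η, hη0, hη1, hη⟩ := mixKernel_step_le hb0 hε0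
  -- With this bound on `δ`, moderate steps satisfy `|J| ≤ (c + θ + 1) δ y ≤ η y`, as the kernel
  -- estimate requires.
  refine ⟨η / (c + θ + 1), by positivity, fun δ hδ hδη => ?_⟩
  rw [le_div_iff₀ (by positivity)] at hδη
  have hU2 : ∫⁻ s, ENNReal.ofReal (s ^ 2) ∂ν < ⊤ := by
    rw [hν, lintegral_map (by fun_prop) hUm]
    exact (hU.integrable_sq).lintegral_lt_top
  have hIev := (tendsto_truncated_drift (κ := κ) hXm hUm hX0 hU0 hX hU hc hθ hδ hmean)
  obtain ⟨Y₀, hY₀⟩ := eventually_atTop.1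
    (hIev.eventually_const_lt (show c₀ < m - κ * σ2 by rw [hc₀]; linarith))
  obtain ⟨X', cs, hX', hcs, hscale⟩ := tail_scale hβ hL hF (1 / δ)
  -- Kernel `s` gains at least `b c₀` times `mixKernel b y s / (y² + s²)`; integrating over `s > y`
  -- gives at least `d` times the tail at `y`.
  set d := b * c₀ * 2 ^ (-(b / 2) - 1) with hd
  have hd0 : 0 < d := by positivity
  -- The factor `cs` offsets the passage from the tail at `δ y` to the tail at `y`, so the cost of
  -- large claims is at most the gain with constant `d`.
  have hsmall : ∀ᶠ x in atTop, lyapunov ν b x ≤ ENNReal.ofReal (cs * d) :=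
    (tendsto_lyapunov hb0 hU2).eventually_le_const (by simpa using mul_pos hcs hd0)
  filter_upwards [hsmall, eventually_ge_atTop 1, eventually_ge_atTop Y₀,
    eventually_ge_atTop (X' / δ)] with x₁ hx1 hx1' hxY hxX y hy
  rw [div_le_iff₀ hδ] at hxX
  have hy1 : 1 ≤ y := hx1'.trans hy.le
  have hy0 : 0 < y := by linarith
  set J : Ω → ℝ := fun ω => truncStep c θ δ y (X ω) (U ω) with hJ
  have hJm : Measurable J :=
    (measurable_truncStep c θ δ).comp (measurable_const.prodMk (hXm.prodMk hUm))
  set A : Set Ω := {ω | U ω ≤ δ * y} with hA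
  have hAm : MeasurableSet A := hUm measurableSet_Iic
  have hI : c₀ < ∫ ω in A, (y * J ω - κ * J ω ^ 2) ∂μ := hY₀ y (hxY.trans hy.le)
  have hJint : Integrable (fun ω => y * J ω - κ * J ω ^ 2) μ := by
    have hJ2 : MemLp J 2 μ := by
      refine ((hX.const_mul (c + θ)).add hU).mono' hJm.aestronglyMeasurable ?_
      filter_upwards [hX0, hU0] with ω h1 h2
      exact abs_truncStep_le hc hθ hδ.le hy1 h1 h2
    exact ((hJ2.integrable one_le_two).const_mul y).sub (hJ2.integrable_sq.const_mul κ)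
  have hJη : ∀ᵐ ω ∂μ, ω ∈ A → |J ω| ≤ η * y := by
    filter_upwards [hX0, hU0] with ω h1 h2 hω
    refine (abs_truncStep_le_mul hc hθ hδ.le hy1 h1 h2 hω).trans ?_
    gcongr
    linarith
  -- large claims
  have hlarge : ∫⁻ ω in Aᶜ, lyapunov ν b (max (y + J ω) x₁) ∂μ ≤
      ENNReal.ofReal d * ν (Set.Ioi y) := by
    have hAc : μ Aᶜ = ν (Set.Ioi (δ * y)) := by
      rw [hν, Measure.map_apply hUm measurableSet_Ioi]
      congr 1
      ext ω
      simp [hA]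
    calc ∫⁻ ω in Aᶜ, lyapunov ν b (max (y + J ω) x₁) ∂μ
        ≤ ∫⁻ _ in Aᶜ, ENNReal.ofReal (cs * d) ∂μ :=
          lintegral_mono fun ω =>
            (lyapunov_antitone ν hb0 (by linarith) (le_max_right _ _)).trans hx1
      _ = ENNReal.ofReal (cs * d) * ν (Set.Ioi (δ * y)) := by rw [setLIntegral_const, hAc]
      _ = ENNReal.ofReal (d * (cs * ν.real (Set.Ioi (δ * y)))) := by
          rw [← ofReal_measureReal, ← ENNReal.ofReal_mul (by positivity)]
          congr 1; ring
      _ ≤ ENNReal.ofReal (d * ν.real (Set.Ioi y)) := by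
          refine ENNReal.ofReal_le_ofReal (mul_le_mul_of_nonneg_left ?_ hd0.le)
          refine (hscale (δ * y) (by nlinarith)).trans (le_of_eq ?_)
          rw [← mul_assoc, one_div_mul_cancel hδ.ne', one_mul]
      _ = ENNReal.ofReal d * ν (Set.Ioi y) := by
          rw [ENNReal.ofReal_mul hd0.le, ofReal_measureReal]
  -- moderate claims, one kernel at a time
  let e : ℝ → ℝ := fun s => b * c₀ * (mixKernel b y s / (y ^ 2 + s ^ 2))
  have he0 : ∀ s, 0 ≤ e s := fun s => by
    have := mixKernel_nonneg b y s
    positivity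
  have hkernel : ∀ s, ∫⁻ ω in A, ENNReal.ofReal (mixKernel b (y + J ω) s) ∂μ +
      ENNReal.ofReal (e s) ≤ ENNReal.ofReal (mixKernel b y s) := by
    intro s
    have hk0 := mixKernel_nonneg b y s
    have hw : 0 < y ^ 2 + s ^ 2 := by positivity
    let g : Ω → ℝ := fun ω =>
      mixKernel b y s * (1 - b / (y ^ 2 + s ^ 2) * (y * J ω - κ * J ω ^ 2))
    have hgint : Integrable g (μ.restrict A) :=
      (((integrable_const 1).sub (hJint.const_mul _)).const_mul _).restrict
    have hle : ∀ᵐ ω ∂μ.restrict A, mixKernel b (y + J ω) s ≤ g ω := by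
      rw [ae_restrict_iff' hAm]
      filter_upwards [hJη] with ω h hω
      exact hη y s (J ω) hy0 (h hω)
    have hg0 : ∀ᵐ ω ∂μ.restrict A, 0 ≤ g ω := by
      filter_upwards [hle] with ω h
      exact (mixKernel_nonneg _ _ _).trans h
    have hgval : ∫ ω in A, g ω ∂μ ≤ mixKernel b y s - e s := by
      have h1 : ∫ ω in A, g ω ∂μ = mixKernel b y s * (μ.real A -
          b / (y ^ 2 + s ^ 2) * ∫ ω in A, (y * J ω - κ * J ω ^ 2) ∂μ) := by
        simp only [g]
        rw [integral_const_mul, integral_sub (integrable_const 1)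
          (hJint.const_mul _).restrict, integral_const_mul]
        simp
      have h2 : mixKernel b y s - e s = mixKernel b y s * (1 - b / (y ^ 2 + s ^ 2) * c₀) := by
        simp only [e]; ring
      rw [h1, h2]
      gcongr
      exact measureReal_le_one
    have hgnn : 0 ≤ ∫ ω in A, g ω ∂μ := integral_nonneg_of_ae hg0
    calc ∫⁻ ω in A, ENNReal.ofReal (mixKernel b (y + J ω) s) ∂μ + ENNReal.ofReal (e s)
        ≤ ∫⁻ ω in A, ENNReal.ofReal (g ω) ∂μ + ENNReal.ofReal (e s) := by
          gcongr ?_ + _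
          exact lintegral_mono_ae (hle.mono fun ω h => ENNReal.ofReal_le_ofReal h)
      _ = ENNReal.ofReal (∫ ω in A, g ω ∂μ) + ENNReal.ofReal (e s) := by
          rw [ofReal_integral_eq_lintegral_ofReal hgint hg0]
      _ = ENNReal.ofReal (∫ ω in A, g ω ∂μ + e s) := (ENNReal.ofReal_add hgnn (he0 s)).symm
      _ ≤ ENNReal.ofReal (mixKernel b y s) := ENNReal.ofReal_le_ofReal (by linarith)
  have hem : Measurable e := by
    have h1 : Measurable fun s => mixKernel b y s :=
      (measurable_mixKernel b).comp (measurable_const.prodMk measurable_id)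
    exact (h1.div (by fun_prop)).const_mul _
  have hmod : ∫⁻ ω in A, lyapunov ν b (max (y + J ω) x₁) ∂μ + ENNReal.ofReal d * ν (Set.Ioi y) ≤
      lyapunov ν b y := by
    have h1 : ∫⁻ ω in A, lyapunov ν b (max (y + J ω) x₁) ∂μ ≤
        ∫⁻ s, ∫⁻ ω in A, ENNReal.ofReal (mixKernel b (y + J ω) s) ∂μ ∂ν := by
      rw [lintegral_lintegral_swap]
      · refine lintegral_mono_ae ?_
        rw [ae_restrict_iff' hAm]
        filter_upwards [hJη] with ω h hω
        have := (abs_le.1 (h hω)).1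
        exact lyapunov_antitone ν hb0 (by nlinarith) (le_max_left _ _)
      · exact ((measurable_mixKernel b).comp
          (((hJm.comp measurable_snd).const_add y).prodMk measurable_fst)).ennreal_ofReal.aemeasurable
    have h2 : ENNReal.ofReal d * ν (Set.Ioi y) ≤ ∫⁻ s, ENNReal.ofReal (e s) ∂ν := by
      calc ENNReal.ofReal d * ν (Set.Ioi y) = ∫⁻ _ in Set.Ioi y, ENNReal.ofReal d ∂ν := by
            rw [setLIntegral_const]
        _ ≤ ∫⁻ s in Set.Ioi y, ENNReal.ofReal (e s) ∂ν := by
            refine setLIntegral_mono hem.ennreal_ofReal fun s hs => ENNReal.ofReal_le_ofReal ?_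
            simp only [e, hd]
            gcongr
            exact mixKernel_div_ge hb0 hy0 hs
        _ ≤ ∫⁻ s, ENNReal.ofReal (e s) ∂ν := setLIntegral_le_lintegral _ _
    calc _ ≤ ∫⁻ s, ∫⁻ ω in A, ENNReal.ofReal (mixKernel b (y + J ω) s) ∂μ ∂ν +
          ∫⁻ s, ENNReal.ofReal (e s) ∂ν := add_le_add h1 h2
      _ = ∫⁻ s, (∫⁻ ω in A, ENNReal.ofReal (mixKernel b (y + J ω) s) ∂μ +
          ENNReal.ofReal (e s)) ∂ν := (lintegral_add_right _ hem.ennreal_ofReal).symm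
      _ ≤ lyapunov ν b y := lintegral_mono hkernel
  calc ∫⁻ ω, lyapunov ν b (max (y + J ω) x₁) ∂μ
      = ∫⁻ ω in A, lyapunov ν b (max (y + J ω) x₁) ∂μ +
        ∫⁻ ω in Aᶜ, lyapunov ν b (max (y + J ω) x₁) ∂μ := (lintegral_add_compl _ hAm).symm
    _ ≤ ∫⁻ ω in A, lyapunov ν b (max (y + J ω) x₁) ∂μ + ENNReal.ofReal d * ν (Set.Ioi y) := by
        gcongr
    _ ≤ lyapunov ν b y := hmod

/-! ### The comparison chain and its hitting probability -/

section ComparisonChain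

variable {Ω : Type*} {τ ξ : ℕ → Ω → ℝ}

/-- The comparison chain below the reserve process, frozen once it is at or below level `x₁`. -/
noncomputable def compChain (c θ δ x₁ : ℝ) (τ ξ : ℕ → Ω → ℝ) (x : ℝ) : ℕ → Ω → ℝ
  | 0, _ => x
  | n + 1, ω => if x₁ < compChain c θ δ x₁ τ ξ x n ω then
      compChain c θ δ x₁ τ ξ x n ω +
        truncStep c θ δ (compChain c θ δ x₁ τ ξ x n ω) (τ n ω) (ξ n ω)
    else compChain c θ δ x₁ τ ξ x n ω

theorem measurable_compStep (c θ δ x₁ : ℝ) : Measurable fun p : ℝ × ℝ × ℝ =>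
    if x₁ < p.1 then p.1 + truncStep c θ δ p.1 p.2.1 p.2.2 else p.1 :=
  Measurable.ite (measurable_fst measurableSet_Ioi)
    (measurable_fst.add (measurable_truncStep c θ δ)) measurable_fst

theorem measurable_compChain (c θ δ x₁ x : ℝ) (n : ℕ) :
    Measurable[inputSigma τ ξ (pastInputs n)] (compChain c θ δ x₁ τ ξ x n) := by
  induction n with
  | zero => exact @measurable_const _ _ _ (_) _
  | succ n ih =>
    have h1 := ih.mono (inputSigma_mono (pastInputs_mono n.le_succ)) le_rfl
    have h2 : Measurable[inputSigma τ ξ (pastInputs (n + 1))] (τ n) :=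
      measurable_inputSigma_left (by simp [pastInputs])
    have h3 : Measurable[inputSigma τ ξ (pastInputs (n + 1))] (ξ n) :=
      measurable_inputSigma_right (by simp [pastInputs])
    exact (measurable_compStep c θ δ x₁).comp (h1.prodMk (h2.prodMk h3))

/-- Cutting the waiting time at `δ y` keeps the growth used here inside `[y, y (1 + (c + θ) δ)]`,
where the rate is at least `c + θ / y`; the discarded time can only raise the reserve. -/
theorem compChain_le_postClaim {v : ℝ → ℝ} {x : ℝ} {R : ℝ → Ω → ℝ} {ω : Ω}
    (h : ReservePath v τ ξ x R ω) (hτ : ∀ n, 0 ≤ τ n ω) (hv : ∀ y, 0 ≤ v y) {c θ δ x₁ : ℝ}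
    (hc : 0 ≤ c) (hθ : 0 ≤ θ) (hδ : 0 ≤ δ) (hx₁ : 1 ≤ x₁)
    (hrate : ∀ y, x₁ < y → ∀ r ∈ Set.Icc y (y * (1 + (c + θ) * δ)), c + θ / y ≤ v r)
    (hY : ∀ n, x₁ < compChain c θ δ x₁ τ ξ x n ω) (n : ℕ) :
    compChain c θ δ x₁ τ ξ x n ω ≤ postClaim v τ ξ x R n ω := by
  induction n with
  | zero => exact postClaim_zero.ge
  | succ n ih =>
    rw [compChain, if_pos (hY n)]
    set y := compChain c θ δ x₁ τ ξ x n ω with hy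
    have hy1 : 1 ≤ y := hx₁.trans (hY n).le
    have hθy : θ / y ≤ θ := div_le_self hθ hy1
    have hθy0 : 0 ≤ θ / y := by positivity
    have hm0 : 0 ≤ min (τ n ω) (δ * y) := le_min (hτ n) (by positivity)
    have hgrow : (c + θ / y) * min (τ n ω) (δ * y) ≤ (c + θ) * (δ * y) :=
      mul_le_mul (by linarith) (min_le_right _ _) hm0 (by linarith)
    have := h.postClaim_succ_ge hτ hv n (add_nonneg hc hθy0) (min_le_left _ (δ * y)) ih
      fun r hr => hrate y (hY n) r ⟨hr.1, hr.2.trans (by linarith)⟩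
    unfold truncStep
    linarith

variable [MeasurableSpace Ω] {μ : Measure Ω} [IsProbabilityMeasure μ]

/-- The mean of `V (max Y x₁)` does not increase along the chain. Freezing makes the events `Y n ≤
x₁` increase with `n`, so Markov's inequality at fixed times replaces optional stopping. -/
theorem measure_compChain_le (hτ : ∀ n, Measurable (τ n)) (hξ : ∀ n, Measurable (ξ n))
    (hindep : iIndepFun (Sum.elim τ ξ) μ)
    (hτ_ident : ∀ n, IdentDistrib (τ n) (τ 0) μ μ) (hξ_ident : ∀ n, IdentDistrib (ξ n) (ξ 0) μ μ)
    {c θ δ x₁ x : ℝ} {V : ℝ → ENNReal} (hV : Measurable V)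
    (hx : x₁ ≤ x) (hVpos : V x₁ ≠ 0) (hVtop : V x₁ ≠ ⊤)
    (hstep : ∀ y, x₁ < y →
      ∫⁻ ω, V (max (y + truncStep c θ δ y (τ 0 ω) (ξ 0 ω)) x₁) ∂μ ≤ V y) :
    μ (⋃ n, {ω | compChain c θ δ x₁ τ ξ x n ω ≤ x₁}) ≤ V x / V x₁ := by
  set Y := compChain c θ δ x₁ τ ξ x with hYdef
  have hYm : ∀ n, Measurable (Y n) := fun n =>
    (measurable_compChain c θ δ x₁ x n).mono (inputSigma_le hτ hξ _) le_rfl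
  have hVm : Measurable fun y => V (max y x₁) := hV.comp (measurable_id.max measurable_const)
  have hsuper : ∀ n, ∫⁻ ω, V (max (Y n ω) x₁) ∂μ ≤ V x := by
    intro n
    induction n with
    | zero => simp [hYdef, compChain, max_eq_left hx]
    | succ n ih =>
      refine le_trans ?_ ih
      let G : ℝ → ℝ × ℝ → ENNReal := fun y p =>
        V (max (if x₁ < y then y + truncStep c θ δ y p.1 p.2 else y) x₁)
      have hG : Measurable (Function.uncurry G) := hVm.comp (measurable_compStep c θ δ x₁)
      calc ∫⁻ ω, V (max (Y (n + 1) ω) x₁) ∂μ = ∫⁻ ω, G (Y n ω) (τ n ω, ξ n ω) ∂μ := rfl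
        _ = ∫⁻ ω, ∫⁻ ω', G (Y n ω) (τ 0 ω', ξ 0 ω') ∂μ ∂μ :=
          lintegral_past_pair hτ hξ hindep hτ_ident hξ_ident
            (measurable_compChain c θ δ x₁ x n) hG
        _ ≤ ∫⁻ ω, V (max (Y n ω) x₁) ∂μ := by
          refine lintegral_mono fun ω => ?_
          simp only [G]
          split_ifs with hlt
          · rw [max_eq_left hlt.le]; exact hstep _ hlt
          · simp
  have hmono : Monotone fun n => {ω | Y n ω ≤ x₁} := by
    refine monotone_nat_of_le_succ fun n ω hω => ?_
    show Y (n + 1) ω ≤ x₁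
    have hω : Y n ω ≤ x₁ := hω
    rw [hYdef, compChain, if_neg (not_lt.2 hω)]
    exact hω
  rw [hmono.measure_iUnion]
  refine iSup_le fun n => ?_
  rw [ENNReal.le_div_iff_mul_le (Or.inl hVpos) (Or.inl hVtop), mul_comm]
  calc V x₁ * μ {ω | Y n ω ≤ x₁} ≤ V x₁ * μ {ω | V x₁ ≤ V (max (Y n ω) x₁)} := by
        gcongr
        intro hω
        rw [max_eq_right hω]
    _ ≤ ∫⁻ ω, V (max (Y n ω) x₁) ∂μ := mul_meas_ge_le_lintegral (hVm.comp (hYm n)) _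
    _ ≤ V x := hsuper n

end ComparisonChain

/-- Half of the slack `θ - θ'` absorbs the error `ε / r`, the other half the ratio `r / y ≤ 1 + (c +
θ') δ`. -/
theorem ApproachesAtRate.lower {v : ℝ → ℝ} {c θ θ' : ℝ} (h : ApproachesAtRate v c θ)
    (hc : 0 ≤ c) (hθ' : 0 < θ') (hθ : θ' < θ) :
    ∃ δ₀ : ℝ, 0 < δ₀ ∧ ∀ δ, 0 < δ → δ ≤ δ₀ → ∀ᶠ x₁ in atTop, ∀ y, x₁ < y →
      ∀ r ∈ Set.Icc y (y * (1 + (c + θ') * δ)), c + θ' / y ≤ v r := by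
  set ε := (θ - θ') / 2 with hε
  have hε0 : 0 < ε := by rw [hε]; linarith
  refine ⟨ε / (θ' * (c + θ')), by positivity, fun δ hδ hδ₀ => ?_⟩
  rw [le_div_iff₀ (by positivity)] at hδ₀
  obtain ⟨Y, hY⟩ := eventually_atTop.1 (h.eventually hε0)
  filter_upwards [eventually_ge_atTop Y, eventually_gt_atTop 0] with x₁ hx hx0 y hy r hr
  have hy0 : 0 < y := hx0.trans hy
  have hr0 : 0 < r := hy0.trans_le hr.1
  have h1 := (abs_le.1 (hY r (by linarith [hr.1]))).1
  have h2 : θ' / y ≤ (θ - ε) / r := by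
    rw [div_le_div_iff₀ hy0 hr0]
    calc θ' * r ≤ θ' * (y * (1 + (c + θ') * δ)) := by gcongr; exact hr.2
      _ = (θ' + δ * (θ' * (c + θ'))) * y := by ring
      _ ≤ (θ - ε) * y := by gcongr; rw [hε] at hδ₀ ⊢; linarith
  rw [sub_div] at h2
  linarith

theorem measureReal_map_Ioi {Ω : Type*} [MeasurableSpace Ω] {μ : Measure Ω} {U : Ω → ℝ}
    (hU : Measurable U) (x : ℝ) : (μ.map U).real (Set.Ioi x) = μ.real {ω | x < U ω} := by
  rw [map_measureReal_apply hU measurableSet_Ioi]; rfl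

theorem integral_sq_eq_limitVariance {Ω : Type*} [MeasurableSpace Ω] {μ : Measure Ω}
    [IsProbabilityMeasure μ] {X U : Ω → ℝ} (hX : MemLp X 2 μ) (hU : MemLp U 2 μ)
    (hXU : IndepFun X U μ) (hmean : 0 < ∫ ω, X ω ∂μ) :
    ∫ ω, (criticalRate μ X U * X ω - U ω) ∂μ = 0 ∧
      ∫ ω, (criticalRate μ X U * X ω - U ω) ^ 2 ∂μ = limitVariance μ X U := by
  set c := criticalRate μ X U with hc
  have h1 : ∫ ω, (c * X ω - U ω) ∂μ = 0 := by
    rw [integral_sub ((hX.integrable one_le_two).const_mul c) (hU.integrable one_le_two),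
      integral_const_mul, hc, criticalRate, div_mul_cancel₀ _ hmean.ne', sub_self]
  refine ⟨h1, ?_⟩
  have hD : MemLp (fun ω => c * X ω - U ω) 2 μ := (hX.const_mul c).sub hU
  rw [← variance_of_integral_eq_zero hD.1.aemeasurable h1]
  have hind : IndepFun (fun ω => c * X ω) (fun ω => -U ω) μ :=
    hXU.comp (φ := fun x => c * x) (ψ := fun x => -x) (by fun_prop) (by fun_prop)
  have := hind.variance_add (hX.const_mul c) hU.neg
  have e : (fun ω => c * X ω - U ω) = (fun ω => c * X ω) + -U := by
    funext ω; simp [sub_eq_add_neg]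
  rw [e, this, variance_const_mul, limitVariance, ← hc, add_comm]
  congr 1
  exact variance_neg

/-! ### Standing assumptions and the upper bound -/

/-- The standing assumptions on the inter-claim times and the claim sizes. -/
structure ClaimInputs {Ω : Type*} [MeasurableSpace Ω] (μ : Measure Ω) (τ ξ : ℕ → Ω → ℝ) :
    Prop where
  meas_time : ∀ n, Measurable (τ n)
  meas_size : ∀ n, Measurable (ξ n)
  nonneg_time : ∀ n, ∀ᵐ ω ∂μ, 0 ≤ τ n ω
  nonneg_size : ∀ n, ∀ᵐ ω ∂μ, 0 ≤ ξ n ω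
  indep : iIndepFun (Sum.elim τ ξ) μ
  ident_time : ∀ n, IdentDistrib (τ n) (τ 0) μ μ
  ident_size : ∀ n, IdentDistrib (ξ n) (ξ 0) μ μ
  mean_pos : 0 < ∫ ω, τ 0 ω ∂μ
  memLp_time : MemLp (τ 0) 2 μ
  memLp_size : MemLp (ξ 0) 2 μ

namespace ClaimInputs

variable {Ω : Type*} [MeasurableSpace Ω] {μ : Measure Ω} {τ ξ : ℕ → Ω → ℝ}

theorem criticalRate_nonneg (h : ClaimInputs μ τ ξ) : 0 ≤ criticalRate μ (τ 0) (ξ 0) :=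
  div_nonneg (integral_nonneg_of_ae (h.nonneg_size 0)) h.mean_pos.le

theorem indepFun_pair (h : ClaimInputs μ τ ξ) (n : ℕ) : IndepFun (τ n) (ξ n) μ :=
  h.indep.indepFun (show Sum.inl n ≠ Sum.inr n by simp)

theorem measureReal_pair (h : ClaimInputs μ τ ξ) (n : ℕ) (t y : ℝ) :
    μ.real {ω | τ n ω ≤ t ∧ y < ξ n ω} =
      μ.real {ω | τ 0 ω ≤ t} * (μ.map (ξ 0)).real (Set.Ioi y) := by
  rw [measureReal_map_Ioi (h.meas_size 0)]
  have h1 := (h.indepFun_pair n).measure_inter_preimage_eq_mul (Set.Iic t) (Set.Ioi y)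
    measurableSet_Iic measurableSet_Ioi
  rw [(h.ident_time n).measure_preimage_eq measurableSet_Iic,
    (h.ident_size n).measure_preimage_eq measurableSet_Ioi] at h1
  simp only [measureReal_def, ← ENNReal.toReal_mul]
  exact congrArg ENNReal.toReal h1

variable [IsProbabilityMeasure μ]

theorem ae_regular (h : ClaimInputs μ τ ξ) : ∀ᵐ ω ∂μ, (∀ n, 0 ≤ τ n ω) ∧ (∀ n, 0 ≤ ξ n ω) ∧
    Tendsto (fun n => claimEpoch τ n ω) atTop atTop := by
  filter_upwards [ae_all_iff.2 h.nonneg_time, ae_all_iff.2 h.nonneg_size,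
    ae_tendsto_claimEpoch h.indep h.ident_time h.mean_pos] with ω h1 h2 h3
  exact ⟨h1, h2, h3⟩

theorem walk_moments (h : ClaimInputs μ τ ξ) :
    ∫ ω, (criticalRate μ (τ 0) (ξ 0) * τ 0 ω - ξ 0 ω) ∂μ = 0 ∧
      ∫ ω, (criticalRate μ (τ 0) (ξ 0) * τ 0 ω - ξ 0 ω) ^ 2 ∂μ =
        limitVariance μ (τ 0) (ξ 0) :=
  integral_sq_eq_limitVariance h.memLp_time h.memLp_size
    (h.indep.indepFun (show Sum.inl 0 ≠ Sum.inr 0 by simp)) h.mean_pos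

/-- Polynomial upper bound for the ruin probability. -/
theorem ruinProb_le (h : ClaimInputs μ τ ξ) {v : ℝ → ℝ} (hv : ∀ y, 0 ≤ v y) {R : ℝ → ℝ → Ω → ℝ}
    (hR : ∀ x : ℝ, 0 < x → IsRiskReserve μ v τ ξ x (R x)) {θ β : ℝ}
    (hrate : ApproachesAtRate v (criticalRate μ (τ 0) (ξ 0)) θ) (hβ : 0 < β)
    (hβρ : β < ruinExponent μ (τ 0) (ξ 0) θ) {L : ℝ → ℝ} (hL : SlowlyVarying L)
    (hF : ∀ x, 0 < x → (μ.map (ξ 0)).real (Set.Ioi x) = x ^ (-2 - β) * L x) :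
    ∃ X C : ℝ, 0 < X ∧ 0 < C ∧ ∀ x, X ≤ x →
      ruinProb μ (R x) ≤ C * (x ^ 2 * (μ.map (ξ 0)).real (Set.Ioi x)) := by
  set c := criticalRate μ (τ 0) (ξ 0) with hc
  have hc0 : 0 ≤ c := h.criticalRate_nonneg
  obtain ⟨hmean, hvar⟩ := h.walk_moments
  set ν := μ.map (ξ 0) with hν
  have : IsProbabilityMeasure ν := Measure.isProbabilityMeasure_map (h.meas_size 0).aemeasurable
  set σ2 := limitVariance μ (τ 0) (ξ 0) with hσ2
  set m := ∫ ω, τ 0 ω ∂μ with hm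
  have hm0 : 0 < m := h.mean_pos
  -- If the variance vanished, division by zero would give the exponent the value `-1`, contrary to
  -- `0 < β < ρ`.
  have hσ0 : 0 < σ2 := by
    have h0 : 0 ≤ σ2 := by rw [← hvar]; exact integral_nonneg fun ω => sq_nonneg _
    refine h0.lt_of_ne fun h0 => ?_
    rw [ruinExponent, ← hσ2, ← h0, div_zero] at hβρ
    linarith
  -- `b > β` gives the size of the Lyapunov function and `b < ρ` the strict drift inequality, which
  -- leaves room to lower `θ` to `θ'`.
  obtain ⟨b, hb, hbρ⟩ := exists_between hβρ
  have hθ1 : (b + 1) / 2 * σ2 / m < θ := by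
    rw [ruinExponent, ← hσ2, ← hm, lt_sub_iff_add_lt, lt_div_iff₀ hσ0] at hbρ
    rw [div_lt_iff₀ hm0]
    linarith
  obtain ⟨θ', hθ'1, hθ'θ⟩ := exists_between hθ1
  have hθ'0 : 0 < θ' := lt_of_le_of_lt (by have := hβ.trans hb; positivity) hθ'1
  rw [div_lt_iff₀ hm0] at hθ'1
  obtain ⟨δ₁, hδ₁, hstep⟩ := lyapunov_step_le (h.meas_time 0) (h.meas_size 0) (h.nonneg_time 0)
    (h.nonneg_size 0) h.memLp_time h.memLp_size hβ hb hL hF hc0 hθ'0.le hmean (by rwa [hvar])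
  obtain ⟨δ₂, hδ₂, hlow⟩ := hrate.lower hc0 hθ'0 hθ'θ
  set δ := min δ₁ δ₂
  have hδ : 0 < δ := lt_min hδ₁ hδ₂
  obtain ⟨x₁, hx1, hx2, hx3⟩ := ((hstep δ hδ (min_le_left _ _)).and
    ((hlow δ hδ (min_le_right _ _)).and (eventually_ge_atTop 1))).exists
  have hν0 : ν (Set.Iio 0) = 0 := by
    rw [hν, Measure.map_apply (h.meas_size 0) measurableSet_Iio]
    refine measure_mono_null ?_ (ae_iff.1 (h.nonneg_size 0))
    exact fun ω hω => not_le.2 hω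
  obtain ⟨X', C', hX', hC', hly⟩ := lyapunov_le hν0 hβ hb hL hF
  have hb0 := hβ.trans hb
  have hpos : lyapunov ν b x₁ ≠ 0 := by
    refine (lyapunov_pos (by linarith) ?_).ne'
    have := tail_pos hL hF 0
    rw [measureReal_def] at this
    exact (ENNReal.toReal_pos_iff.1 this).1
  have htop : lyapunov ν b x₁ ≠ ⊤ := by
    refine ((lintegral_mono fun s => ENNReal.ofReal_le_ofReal
      (mixKernel_le_sq hb0 (by linarith) s)).trans_lt ?_).ne
    exact lintegral_sq_lt_top hν0 hβ hL hF
  set l := (lyapunov ν b x₁).toReal with hl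
  have hl0 : 0 < l := ENNReal.toReal_pos hpos htop
  refine ⟨max X' x₁, C' / l, by positivity, by positivity, fun x hx => ?_⟩
  have hxX : X' ≤ x := (le_max_left _ _).trans hx
  have hxx : x₁ ≤ x := (le_max_right _ _).trans hx
  have hruin : μ {ω | ∃ t : ℝ, 0 ≤ t ∧ R x t ω < 0} ≤
      μ (⋃ n, {ω | compChain c θ' δ x₁ τ ξ x n ω ≤ x₁}) := by
    refine measure_mono_ae ?_
    filter_upwards [h.ae_regular, hR x (by linarith)] with ω ⟨h1, h2, h3⟩ hpath hru
    obtain ⟨t, ht, hneg⟩ := hru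
    by_contra hnot
    have hY : ∀ n, x₁ < compChain c θ' δ x₁ τ ξ x n ω := fun n => by
      by_contra! hle
      exact hnot (Set.mem_iUnion.2 ⟨n, hle⟩)
    have hpath : ReservePath v τ ξ x (R x) ω := hpath
    have hZ : ∀ n, 0 ≤ postClaim v τ ξ x (R x) n ω := fun n => by
      have := compChain_le_postClaim hpath h1 hv hc0 hθ'0.le hδ.le hx3 hx2 hY n
      linarith [hY n]
    exact absurd hneg (not_lt.2 (hpath.nonneg h1 h3 hv hZ ht))
  have hbound : μ {ω | ∃ t : ℝ, 0 ≤ t ∧ R x t ω < 0} ≤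
      ENNReal.ofReal (C' / l * (x ^ 2 * ν.real (Set.Ioi x))) := by
    refine (hruin.trans (measure_compChain_le h.meas_time h.meas_size h.indep h.ident_time
      h.ident_size (measurable_lyapunov ν b) hxx hpos htop hx1)).trans ?_
    rw [← ENNReal.ofReal_toReal htop, ← hl]
    refine (ENNReal.div_le_div_right (hly x hxX) _).trans (le_of_eq ?_)
    rw [← ENNReal.ofReal_div_of_pos hl0]
    congr 1; ring
  have hFx := tail_pos hL hF x
  exact ENNReal.toReal_le_of_le_ofReal (by positivity) hbound

end ClaimInputs

/-! ### The lower bound: one large claim in about `x²` -/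

theorem ApproachesAtRate.upper {v : ℝ → ℝ} {c θ : ℝ} (h : ApproachesAtRate v c θ) (hθ : 0 ≤ θ) :
    ∀ᶠ x in atTop, ∀ r, x ≤ r → v r ≤ c + (θ + 1) / x := by
  obtain ⟨Y, hY⟩ := eventually_atTop.1 (h.eventually one_pos)
  filter_upwards [eventually_ge_atTop Y, eventually_gt_atTop 0] with x hx hx0 r hr
  have h1 := (abs_le.1 (hY r (hx.trans hr))).2
  have h2 : (θ + 1) / r ≤ (θ + 1) / x := by gcongr
  rw [add_div] at h2
  linarith

section Control

variable {Ω : Type*} {τ ξ : ℕ → Ω → ℝ}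

/-- A functional of the past controlling both the stopped walk and the individual inputs. -/
noncomputable def pastEnergy (τ ξ : ℕ → Ω → ℝ) (c a : ℝ) (k : ℕ) (ω : Ω) : ℝ :=
  stoppedWalk τ ξ c a k ω ^ 2 + ∑ i ∈ Finset.range k, (τ i ω + τ i ω ^ 2 + ξ i ω ^ 2)

theorem measurable_pastEnergy (c a : ℝ) (k : ℕ) :
    Measurable[inputSigma τ ξ (pastInputs k)] (pastEnergy τ ξ c a k) := by
  refine ((measurable_stoppedWalk c a k).pow_const 2).add
    (Finset.measurable_fun_sum _ fun i hi => ?_)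
  have hi := Finset.mem_range.1 hi
  have h2 : Measurable[inputSigma τ ξ (pastInputs k)] (τ i) :=
    measurable_inputSigma_left (by simpa [pastInputs] using hi)
  have h3 : Measurable[inputSigma τ ξ (pastInputs k)] (ξ i) :=
    measurable_inputSigma_right (by simpa [pastInputs] using hi)
  exact (h2.add (h2.pow_const 2)).add (h3.pow_const 2)

theorem pastEnergy_bounds {c a : ℝ} {k : ℕ} {ω : Ω} (hτ : ∀ n, 0 ≤ τ n ω) (ha : 0 ≤ a)
    (h : pastEnergy τ ξ c a k ω ≤ a ^ 2) :
    |stoppedWalk τ ξ c a k ω| ≤ a ∧ claimEpoch τ k ω ≤ a ^ 2 ∧ ∀ i < k, ξ i ω ≤ a := by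
  have h0 : ∀ i ∈ Finset.range k, 0 ≤ τ i ω + τ i ω ^ 2 + ξ i ω ^ 2 := fun i _ => by
    have := hτ i
    positivity
  have hs := Finset.sum_nonneg h0
  have hw := sq_nonneg (stoppedWalk τ ξ c a k ω)
  unfold pastEnergy at h
  refine ⟨abs_le_of_sq_le_sq (by linarith) ha, ?_, fun i hi => ?_⟩
  · refine le_trans (Finset.sum_le_sum fun i _ => ?_)
      (show ∑ i ∈ Finset.range k, (τ i ω + τ i ω ^ 2 + ξ i ω ^ 2) ≤ a ^ 2 by linarith)
    nlinarith [sq_nonneg (τ i ω), sq_nonneg (ξ i ω)]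
  · have h1 := Finset.single_le_sum h0 (Finset.mem_range.2 hi)
    refine abs_le_of_sq_le_sq' ?_ ha |>.2
    nlinarith [sq_nonneg (τ i ω), hτ i]

/-- A large claim leads to ruin when the past is controlled. -/
theorem ReservePath.postClaim_neg {v : ℝ → ℝ} {x : ℝ} {R : ℝ → Ω → ℝ} {ω : Ω}
    (h : ReservePath v τ ξ x R ω) (hτ : ∀ n, 0 ≤ τ n ω) (hv : ∀ y, 0 ≤ v y) {c C : ℝ}
    (hc : 0 ≤ c) (hC : 0 ≤ C) (hx : 1 ≤ x) (hvc : ∀ r, x ≤ r → v r ≤ c + C / x) {k : ℕ}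
    (hQ : pastEnergy τ ξ c x k ω ≤ x ^ 2) (hτk : τ k ω ≤ x) (hξk : (3 + 2 * C + c) * x < ξ k ω) :
    postClaim v τ ξ x R (k + 1) ω < 0 := by
  have hx0 : 0 < x := by linarith
  have hCx : 0 ≤ C / x := by positivity
  obtain ⟨hS, hT, -⟩ := pastEnergy_bounds hτ hx0.le hQ
  -- The surplus rate `C / x` acts for a time at most `x²`, so it adds at most `C x`.
  have hW : ∀ i, ∑ j ∈ Finset.range i, ((c + C / x) * τ j ω - ξ j ω) =
      ∑ j ∈ Finset.range i, (c * τ j ω - ξ j ω) + C / x * claimEpoch τ i ω := by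
    intro i
    rw [claimEpoch, Finset.mul_sum, ← Finset.sum_add_distrib]
    exact Finset.sum_congr rfl fun j _ => by ring
  have hSi := stoppedWalk_eq hS
  have hlow : ∀ i < k, -x ≤ ∑ j ∈ Finset.range i, ((c + C / x) * τ j ω - ξ j ω) := by
    intro i hi
    obtain ⟨e, hb⟩ := hSi i hi.le
    rw [e] at hb
    rw [hW]
    have := mul_nonneg hCx (claimEpoch_nonneg hτ i)
    linarith [(abs_le.1 hb).1]
  have h1 := h.postClaim_le_walk hτ hv (add_nonneg hc hCx) hx0.le hvc hlow
  obtain ⟨e, hb⟩ := hSi k le_rfl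
  rw [e] at hb
  rw [hW] at h1
  have h2 : C / x * claimEpoch τ k ω ≤ C * x := by
    calc C / x * claimEpoch τ k ω ≤ C / x * x ^ 2 := by gcongr
      _ = C * x := by field_simp
  have h3 := h.postClaim_succ_le hτ hv k (add_nonneg hc hCx) hvc
  -- Initial reserve, allowance `m = x`, walk and surplus rate give `(3 + C) x`; the next premium
  -- adds at most `(c + C) x`. Hence the threshold for the claim.
  have h4 : max (postClaim v τ ξ x R k ω) x ≤ (3 + C) * x :=
    max_le (by linarith [(abs_le.1 hb).2]) (by nlinarith)
  have h5 : (c + C / x) * τ k ω ≤ (c + C) * x :=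
    mul_le_mul (by linarith [div_le_self hC hx]) hτk (hτ k) (by positivity)
  linarith

end Control

namespace ClaimInputs

variable {Ω : Type*} [MeasurableSpace Ω] {μ : Measure Ω} [IsProbabilityMeasure μ]
  {τ ξ : ℕ → Ω → ℝ}

theorem measureReal_time_le (h : ClaimInputs μ τ ξ) {t : ℝ} (ht : 2 * ∫ ω, τ 0 ω ∂μ ≤ t) :
    1 / 2 ≤ μ.real {ω | τ 0 ω ≤ t} := by
  have hm := h.mean_pos
  have h1 := mul_meas_ge_le_integral_of_nonneg (h.nonneg_time 0)
    (h.memLp_time.integrable one_le_two) t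
  have h2 : μ.real {ω | τ 0 ω ≤ t}ᶜ ≤ μ.real {ω | t ≤ τ 0 ω} :=
    measureReal_mono fun ω hω => le_of_lt (not_le.1 (show ¬ τ 0 ω ≤ t from hω))
  rw [probReal_compl_eq_one_sub (measurableSet_le (h.meas_time 0) measurable_const)] at h2
  have h3 : t * (1 - μ.real {ω | τ 0 ω ≤ t}) ≤ t * μ.real {ω | t ≤ τ 0 ω} :=
    mul_le_mul_of_nonneg_left h2 (by linarith)
  nlinarith

/-- The ruin probability is bounded below on bounded sets of initial reserves. -/
theorem ruinProb_ge_of_le (h : ClaimInputs μ τ ξ) {v : ℝ → ℝ} (hv : ∀ y, 0 ≤ v y) {M : ℝ}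
    (hM : ∀ y, v y ≤ M) {R : ℝ → ℝ → Ω → ℝ}
    (hR : ∀ x : ℝ, 0 < x → IsRiskReserve μ v τ ξ x (R x))
    (hF : ∀ x, 0 < (μ.map (ξ 0)).real (Set.Ioi x)) (X : ℝ) :
    ∃ c : ℝ, 0 < c ∧ ∀ x, 0 < x → x ≤ X → c ≤ ruinProb μ (R x) := by
  set t := 2 * ∫ ω, τ 0 ω ∂μ with ht
  have hM0 : 0 ≤ M := (hv 0).trans (hM 0)
  -- Ruin at the first claim: with probability at least `1/2` it comes before time `t`, when the
  -- reserve is at most `X + M t`.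
  refine ⟨1 / 2 * (μ.map (ξ 0)).real (Set.Ioi (X + M * t)), mul_pos (by norm_num) (hF _),
    fun x hx hxX => ?_⟩
  have h1 : 1 / 2 * (μ.map (ξ 0)).real (Set.Ioi (X + M * t)) ≤
      μ.real {ω | τ 0 ω ≤ t ∧ X + M * t < ξ 0 ω} := by
    rw [h.measureReal_pair]
    exact mul_le_mul_of_nonneg_right (h.measureReal_time_le le_rfl) measureReal_nonneg
  refine h1.trans (ENNReal.toReal_mono (measure_ne_top _ _) (measure_mono_ae ?_))
  filter_upwards [h.ae_regular, hR x hx] with ω ⟨h1, h2, h3⟩ hpath hω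
  have hpath : ReservePath v τ ξ x (R x) ω := hpath
  obtain ⟨hω1, hω2⟩ := hω
  refine hpath.exists_neg h1 h2 h3 (n := 1) ?_
  have := hpath.postClaim_succ_le h1 hv 0 (y := x) hM0 fun r _ => hM r
  rw [postClaim_zero, max_self] at this
  have h4 : M * τ 0 ω ≤ M * t := by gcongr
  linarith

theorem integral_pastEnergy_le (h : ClaimInputs μ τ ξ) (a : ℝ) (n : ℕ) :
    Integrable (pastEnergy τ ξ (criticalRate μ (τ 0) (ξ 0)) a n) μ ∧
    ∫ ω, pastEnergy τ ξ (criticalRate μ (τ 0) (ξ 0)) a n ω ∂μ ≤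
      n * (limitVariance μ (τ 0) (ξ 0) +
        ((∫ ω, τ 0 ω ∂μ) + (∫ ω, τ 0 ω ^ 2 ∂μ) + ∫ ω, ξ 0 ω ^ 2 ∂μ)) := by
  obtain ⟨hS, hS2⟩ := stoppedWalk_second_moment h.meas_time h.meas_size h.indep h.ident_time
    h.ident_size h.memLp_time h.memLp_size h.walk_moments.1 a n
  rw [h.walk_moments.2] at hS2
  have hτ2 : ∀ i, MemLp (τ i) 2 μ := fun i => (h.ident_time i).memLp_iff.2 h.memLp_time
  have hξ2 : ∀ i, MemLp (ξ i) 2 μ := fun i => (h.ident_size i).memLp_iff.2 h.memLp_size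
  have hi1 : ∀ i, Integrable (fun ω => τ i ω + τ i ω ^ 2) μ := fun i =>
    ((hτ2 i).integrable one_le_two).add (hτ2 i).integrable_sq
  have hi : ∀ i, Integrable (fun ω => τ i ω + τ i ω ^ 2 + ξ i ω ^ 2) μ := fun i =>
    (hi1 i).add (hξ2 i).integrable_sq
  have e1 : ∀ i, ∫ ω, τ i ω ^ 2 ∂μ = ∫ ω, τ 0 ω ^ 2 ∂μ := fun i =>
    ((h.ident_time i).comp (u := fun y : ℝ => y ^ 2) (by fun_prop)).integral_eq
  have e2 : ∀ i, ∫ ω, ξ i ω ^ 2 ∂μ = ∫ ω, ξ 0 ω ^ 2 ∂μ := fun i =>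
    ((h.ident_size i).comp (u := fun y : ℝ => y ^ 2) (by fun_prop)).integral_eq
  have hint : ∀ i, ∫ ω, (τ i ω + τ i ω ^ 2 + ξ i ω ^ 2) ∂μ =
      (∫ ω, τ 0 ω ∂μ) + (∫ ω, τ 0 ω ^ 2 ∂μ) + ∫ ω, ξ 0 ω ^ 2 ∂μ := by
    intro i
    rw [integral_add (hi1 i) (hξ2 i).integrable_sq,
      integral_add ((hτ2 i).integrable one_le_two) (hτ2 i).integrable_sq,
      (h.ident_time i).integral_eq, e1, e2]
  have hsum := integrable_finsetSum (Finset.range n) fun i _ => hi i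
  refine ⟨hS.integrable_sq.add hsum, ?_⟩
  unfold pastEnergy
  rw [integral_add hS.integrable_sq hsum, integral_finsetSum _ fun i _ => hi i]
  simp only [hint, Finset.sum_const, Finset.card_range, nsmul_eq_mul]
  linarith

/-- Lower bound for the ruin probability for large initial reserves. -/
theorem ruinProb_ge (h : ClaimInputs μ τ ξ) {v : ℝ → ℝ} (hv : ∀ y, 0 ≤ v y) {R : ℝ → ℝ → Ω → ℝ}
    (hR : ∀ x : ℝ, 0 < x → IsRiskReserve μ v τ ξ x (R x)) {θ β : ℝ} (hθ : 0 ≤ θ)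
    (hrate : ApproachesAtRate v (criticalRate μ (τ 0) (ξ 0)) θ) (hβ : 0 < β)
    {L : ℝ → ℝ} (hL : SlowlyVarying L)
    (hF : ∀ x, 0 < x → (μ.map (ξ 0)).real (Set.Ioi x) = x ^ (-2 - β) * L x) :
    ∃ X C : ℝ, 0 < X ∧ 0 < C ∧ ∀ x, X ≤ x →
      C * (x ^ 2 * (μ.map (ξ 0)).real (Set.Ioi x)) ≤ ruinProb μ (R x) := by
  have hc0 : 0 ≤ criticalRate μ (τ 0) (ξ 0) := h.criticalRate_nonneg
  have hctrl := h.integral_pastEnergy_le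
  set c := criticalRate μ (τ 0) (ξ 0) with hc
  set ν := μ.map (ξ 0) with hν
  have : IsProbabilityMeasure ν := Measure.isProbabilityMeasure_map (h.meas_size 0).aemeasurable
  set E := limitVariance μ (τ 0) (ξ 0) +
        ((∫ ω, τ 0 ω ∂μ) + (∫ ω, τ 0 ω ^ 2 ∂μ) + ∫ ω, ξ 0 ω ^ 2 ∂μ) with hE
  have hE0 : 0 < E := by
    have h1 : 0 ≤ limitVariance μ (τ 0) (ξ 0) := by
      rw [← h.walk_moments.2]; exact integral_nonneg fun ω => sq_nonneg _
    have h2 : 0 ≤ ∫ ω, τ 0 ω ^ 2 ∂μ := integral_nonneg fun ω => sq_nonneg _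
    have h3 : 0 ≤ ∫ ω, ξ 0 ω ^ 2 ∂μ := integral_nonneg fun ω => sq_nonneg _
    have := h.mean_pos
    positivity
  -- For `k ≤ ε x²` the mean energy is at most `x² / 2`, and Markov's inequality gives probability
  -- at least `1/2`.
  set ε := 1 / (2 * E) with hε
  have hε0 : 0 < ε := by positivity
  set K := 3 + 2 * (θ + 1) + c with hK
  have hK1 : 1 ≤ K := by linarith
  obtain ⟨X', cs, -, hcs, hscale⟩ := tail_scale hβ hL hF K
  obtain ⟨X₁, hX₁⟩ := eventually_atTop.1 (((hrate.upper hθ).and (eventually_ge_atTop 1)).and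
    (((eventually_ge_atTop X').and (eventually_ge_atTop (2 / ε))).and
      (eventually_ge_atTop (2 * ∫ ω, τ 0 ω ∂μ))))
  refine ⟨max X₁ 1, ε * cs / 8, by positivity, by positivity, fun x hx => ?_⟩
  obtain ⟨⟨hup, hx1⟩, ⟨hxX', hxε⟩, hxm⟩ := hX₁ x ((le_max_left _ _).trans hx)
  have hx0 : 0 < x := by linarith
  rw [div_le_iff₀ hε0] at hxε
  set n := ⌊ε * x ^ 2⌋₊ with hn
  have hn1 : (n : ℝ) ≤ ε * x ^ 2 := Nat.floor_le (by positivity)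
  have hn2 : ε * x ^ 2 / 2 ≤ n := by
    have h1 := Nat.lt_floor_add_one (ε * x ^ 2)
    have h2 : 2 ≤ ε * x ^ 2 := by nlinarith
    linarith
  have hQm : ∀ k, Measurable (pastEnergy τ ξ c x k) := fun k =>
    (measurable_pastEnergy c x k).mono (inputSigma_le h.meas_time h.meas_size _) le_rfl
  -- the past is controlled with probability at least one half
  have hhalf : ∀ k ∈ Finset.range n, 1 / 2 ≤ μ.real {ω | pastEnergy τ ξ c x k ω ≤ x ^ 2} := by
    intro k hk
    have hk := Finset.mem_range.1 hk
    obtain ⟨hi, hle⟩ := hctrl x k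
    have hQ0 : 0 ≤ᵐ[μ] pastEnergy τ ξ c x k := by
      filter_upwards [h.ae_regular] with ω hω
      refine add_nonneg (sq_nonneg _) (Finset.sum_nonneg fun i _ => ?_)
      have := hω.1 i
      positivity
    have h1 := mul_meas_ge_le_integral_of_nonneg hQ0 hi (x ^ 2)
    have h2 : μ.real {ω | pastEnergy τ ξ c x k ω ≤ x ^ 2}ᶜ ≤
        μ.real {ω | x ^ 2 ≤ pastEnergy τ ξ c x k ω} :=
      measureReal_mono fun ω hω => le_of_lt (not_le.1 (show ¬ pastEnergy τ ξ c x k ω ≤ x ^ 2 from hω))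
    rw [probReal_compl_eq_one_sub (measurableSet_le (hQm k) measurable_const)] at h2
    have hkn : (k : ℝ) ≤ n := by exact_mod_cast hk.le
    have h3 : x ^ 2 * (1 - μ.real {ω | pastEnergy τ ξ c x k ω ≤ x ^ 2}) ≤ x ^ 2 * (1 / 2) := by
      calc _ ≤ x ^ 2 * μ.real {ω | x ^ 2 ≤ pastEnergy τ ξ c x k ω} := by gcongr
        _ ≤ k * E := h1.trans hle
        _ ≤ ε * x ^ 2 * E := by gcongr; exact hkn.trans hn1
        _ = x ^ 2 * (1 / 2) := by rw [hε]; field_simp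
    have := le_of_mul_le_mul_left h3 (by positivity)
    linarith
  let B : ℕ → Set Ω := fun k =>
    {ω | pastEnergy τ ξ c x k ω ≤ x ^ 2} ∩ {ω | τ k ω ≤ x ∧ K * x < ξ k ω}
  have hBm : ∀ k, MeasurableSet (B k) := fun k => (hQm k measurableSet_Iic).inter
    ((h.meas_time k measurableSet_Iic).inter (h.meas_size k measurableSet_Ioi))
  have hBge : ∀ k ∈ Finset.range n, 1 / 4 * ν.real (Set.Ioi (K * x)) ≤ μ.real (B k) := by
    intro k hk
    have h1 := (indepFun_past h.meas_time h.meas_size h.indep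
      (measurable_pastEnergy c x k)).measure_inter_preimage_eq_mul (Set.Iic (x ^ 2))
      (Set.Iic x ×ˢ Set.Ioi (K * x)) measurableSet_Iic (measurableSet_Iic.prod measurableSet_Ioi)
    have h2 : μ.real (B k) = μ.real {ω | pastEnergy τ ξ c x k ω ≤ x ^ 2} *
        μ.real {ω | τ k ω ≤ x ∧ K * x < ξ k ω} := by
      simp only [measureReal_def, ← ENNReal.toReal_mul]
      exact congrArg ENNReal.toReal h1
    rw [h2, h.measureReal_pair, ← mul_assoc]
    refine mul_le_mul_of_nonneg_right ?_ measureReal_nonneg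
    calc (1 / 4 : ℝ) = 1 / 2 * (1 / 2) := by norm_num
      _ ≤ _ := mul_le_mul (hhalf k hk) (h.measureReal_time_le hxm) (by norm_num)
        measureReal_nonneg
  -- The energy controls each single claim when the times are nonnegative; restricting to this
  -- full-measure event makes the events truly disjoint.
  let Ω₀ : Set Ω := {ω | ∀ n, 0 ≤ τ n ω}
  have hΩ₀m : MeasurableSet Ω₀ := by
    simp only [Ω₀, Set.ofPred_forall]
    exact MeasurableSet.iInter fun n => h.meas_time n measurableSet_Ici
  have hΩ₀ : ∀ k, μ.real (B k ∩ Ω₀) = μ.real (B k) := fun k => by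
    refine measureReal_congr ?_
    filter_upwards [h.ae_regular] with ω hω
    exact propext ⟨fun hb => hb.1, fun hb => ⟨hb, hω.1⟩⟩
  -- For `i < j`, the event `B i` forces `ξ i > K x ≥ x`, whereas the energy bound in `B j` forces
  -- `ξ i ≤ x`.
  have hdisj : Set.PairwiseDisjoint (Finset.range n : Set ℕ) fun k => B k ∩ Ω₀ := by
    have key : ∀ i j, i < j → Disjoint (B i ∩ Ω₀) (B j ∩ Ω₀) := by
      intro i j hij
      rw [Set.disjoint_left]
      rintro ω ⟨hi, -⟩ ⟨hj, h0⟩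
      have h1 := (pastEnergy_bounds h0 hx0.le hj.1).2.2 i hij
      have h2 : K * x < ξ i ω := hi.2.2
      nlinarith
    intro i _ j _ hij
    rcases lt_or_gt_of_ne hij with h | h
    · exact key i j h
    · exact (key j i h).symm
  have hsum : (n : ℝ) * (1 / 4 * ν.real (Set.Ioi (K * x))) ≤
      μ.real (⋃ k ∈ Finset.range n, B k ∩ Ω₀) := by
    rw [measureReal_biUnion_finset hdisj fun k _ => (hBm k).inter hΩ₀m]
    have := Finset.card_nsmul_le_sum (Finset.range n) (fun k => μ.real (B k ∩ Ω₀)) _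
      fun k hk => by rw [hΩ₀]; exact hBge k hk
    rwa [Finset.card_range, nsmul_eq_mul] at this
  have hruin : μ.real (⋃ k ∈ Finset.range n, B k ∩ Ω₀) ≤ ruinProb μ (R x) := by
    refine ENNReal.toReal_mono (measure_ne_top _ _) (measure_mono_ae ?_)
    filter_upwards [h.ae_regular, hR x hx0] with ω ⟨h1, h2, h3⟩ hpath hω
    obtain ⟨k, -, hk⟩ := Set.mem_iUnion₂.1 hω
    have hpath : ReservePath v τ ξ x (R x) ω := hpath
    exact hpath.exists_neg h1 h2 h3 (hpath.postClaim_neg h1 hv hc0 (by linarith) hx1 hup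
      hk.1.1 hk.1.2.1 hk.1.2.2)
  have hKF := hscale x hxX'
  have hFx : 0 ≤ ν.real (Set.Ioi x) := measureReal_nonneg
  calc ε * cs / 8 * (x ^ 2 * ν.real (Set.Ioi x))
      = ε * x ^ 2 / 2 * (1 / 4 * (cs * ν.real (Set.Ioi x))) := by ring
    _ ≤ n * (1 / 4 * ν.real (Set.Ioi (K * x))) := by gcongr
    _ ≤ ruinProb μ (R x) := hsum.trans hruin

end ClaimInputs

/-! ### From large reserves to all reserves; the integrated tail -/

/-- Two-sided bounds near infinity extend to a set on which both functions are bounded above and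
away from zero up to a finite level. -/
theorem exists_two_sided_bound {ψ g : ℝ → ℝ} {S : Set ℝ} {X c C c' l u : ℝ} (hc : 0 < c)
    (hC : 0 < C) (hc' : 0 < c') (hl : 0 < l) (hg : ∀ x ∈ S, 0 ≤ g x)
    (hlarge : ∀ x ∈ S, X ≤ x → c * g x ≤ ψ x ∧ ψ x ≤ C * g x)
    (hsmall : ∀ x ∈ S, x ≤ X → (c' ≤ ψ x ∧ ψ x ≤ 1) ∧ l ≤ g x ∧ g x ≤ u) :
    ∃ C₁ C₂ : ℝ, 0 < C₁ ∧ 0 < C₂ ∧ ∀ x ∈ S, C₁ * g x ≤ ψ x ∧ ψ x ≤ C₂ * g x := by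
  set u' := max u 1
  have hu' : 0 < u' := by positivity
  refine ⟨min c (c' / u'), max C (1 / l), by positivity, by positivity, fun x hx => ?_⟩
  have hgx := hg x hx
  rcases le_total X x with h | h
  · obtain ⟨h1, h2⟩ := hlarge x hx h
    exact ⟨(mul_le_mul_of_nonneg_right (min_le_left _ _) hgx).trans h1,
      h2.trans (mul_le_mul_of_nonneg_right (le_max_left _ _) hgx)⟩
  · obtain ⟨⟨h1, h2⟩, h3, h4⟩ := hsmall x hx h
    constructor
    · calc min c (c' / u') * g x ≤ c' / u' * u' :=
            mul_le_mul (min_le_right _ _) (h4.trans (le_max_left _ _)) hgx (by positivity)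
        _ = c' := by field_simp
        _ ≤ ψ x := h1
    · calc ψ x ≤ 1 / l * l := by rw [one_div_mul_cancel hl.ne']; exact h2
        _ ≤ max C (1 / l) * g x := mul_le_mul (le_max_right _ _) h3 hl.le (by positivity)

section IntegratedTail

variable {ν : Measure ℝ} [IsProbabilityMeasure ν] {β : ℝ} {L : ℝ → ℝ}

theorem integrableOn_mul_tail (hβ : 0 < β) (hL : SlowlyVarying L)
    (hF : ∀ x, 0 < x → ν.real (Set.Ioi x) = x ^ (-2 - β) * L x) :
    IntegrableOn (fun y : ℝ => y * ν.real (Set.Ioi y)) (Set.Ioi 0) := by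
  obtain ⟨X, C, hX, -, h⟩ := lintegral_mul_tail_Ioi_le hβ hL hF
  have hm : Measurable fun y : ℝ => y * ν.real (Set.Ioi y) :=
    measurable_id.mul (tail_antitone ν).measurable
  rw [← Set.Ioc_union_Ioi_eq_Ioi hX.le]
  refine IntegrableOn.union ?_ ⟨hm.aestronglyMeasurable, ?_⟩
  · refine Measure.integrableOn_of_bounded (M := X) (by simp) hm.aestronglyMeasurable ?_
    refine (ae_restrict_iff' measurableSet_Ioc).2 (Eventually.of_forall fun y hy => ?_)
    rw [Real.norm_eq_abs, abs_of_nonneg (mul_nonneg hy.1.le measureReal_nonneg)]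
    exact (mul_le_of_le_one_right hy.1.le measureReal_le_one).trans hy.2
  · rw [hasFiniteIntegral_iff_ofReal]
    · exact (h X le_rfl).trans_lt ENNReal.ofReal_lt_top
    · refine (ae_restrict_iff' measurableSet_Ioi).2 (Eventually.of_forall fun y hy => ?_)
      exact mul_nonneg (hX.trans hy).le measureReal_nonneg

theorem integral_mul_tail_antitone (hβ : 0 < β) (hL : SlowlyVarying L)
    (hF : ∀ x, 0 < x → ν.real (Set.Ioi x) = x ^ (-2 - β) * L x) {x y : ℝ} (hx : 0 ≤ x)
    (hxy : x ≤ y) : ∫ s in Set.Ioi y, s * ν.real (Set.Ioi s) ≤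
      ∫ s in Set.Ioi x, s * ν.real (Set.Ioi s) := by
  refine setIntegral_mono_set ((integrableOn_mul_tail hβ hL hF).mono_set
    (Set.Ioi_subset_Ioi hx)) ?_ (Set.Ioi_subset_Ioi hxy).eventuallyLE
  refine (ae_restrict_iff' measurableSet_Ioi).2 (Eventually.of_forall fun s hs => ?_)
  exact mul_nonneg (hx.trans (le_of_lt hs)) measureReal_nonneg

/-- The integrated tail `∫_x^∞ y P(ξ > y) dy` is comparable with `x² P(ξ > x)`. -/
theorem integral_mul_tail_bounds (hβ : 0 < β) (hL : SlowlyVarying L)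
    (hF : ∀ x, 0 < x → ν.real (Set.Ioi x) = x ^ (-2 - β) * L x) :
    ∃ X a A : ℝ, 0 < X ∧ 0 < a ∧ 0 < A ∧ ∀ x, X ≤ x →
      a * (x ^ 2 * ν.real (Set.Ioi x)) ≤ ∫ y in Set.Ioi x, y * ν.real (Set.Ioi y) ∧
      ∫ y in Set.Ioi x, y * ν.real (Set.Ioi y) ≤ A * (x ^ 2 * ν.real (Set.Ioi x)) := by
  obtain ⟨X, A, hX, hA, h⟩ := lintegral_mul_tail_Ioi_le hβ hL hF
  obtain ⟨X', a, hX', ha, h'⟩ := tail_scale hβ hL hF 2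
  refine ⟨max X X', a, A, by positivity, ha, hA, fun x hx => ?_⟩
  have hx1 := (le_max_left _ _).trans hx
  have hx2 := (le_max_right _ _).trans hx
  have hx0 : 0 < x := hX.trans_le hx1
  have hint := (integrableOn_mul_tail hβ hL hF).mono_set (Set.Ioi_subset_Ioi hx0.le)
  have hnn : ∀ᵐ y ∂volume.restrict (Set.Ioi x), 0 ≤ y * ν.real (Set.Ioi y) :=
    (ae_restrict_iff' measurableSet_Ioi).2 (Eventually.of_forall fun y hy =>
      mul_nonneg (hx0.trans hy).le measureReal_nonneg)
  constructor
  · calc a * (x ^ 2 * ν.real (Set.Ioi x)) = x * (x * (a * ν.real (Set.Ioi x))) := by ring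
      _ ≤ x * (x * ν.real (Set.Ioi (2 * x))) := by gcongr; exact h' x hx2
      _ = ∫ _ in Set.Ioc x (2 * x), x * ν.real (Set.Ioi (2 * x)) := by
        rw [setIntegral_const, Real.volume_real_Ioc_of_le (by linarith), smul_eq_mul]; ring
      _ ≤ ∫ y in Set.Ioc x (2 * x), y * ν.real (Set.Ioi y) := by
        refine setIntegral_mono_on (integrableOn_const (by simp)) (hint.mono_set Set.Ioc_subset_Ioi_self)
          measurableSet_Ioc fun y hy => ?_
        exact mul_le_mul hy.1.le (tail_antitone ν hy.2) measureReal_nonneg (hx0.trans hy.1).le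
      _ ≤ ∫ y in Set.Ioi x, y * ν.real (Set.Ioi y) :=
        setIntegral_mono_set hint hnn Set.Ioc_subset_Ioi_self.eventuallyLE
  · rw [integral_eq_lintegral_of_nonneg_ae hnn hint.1]
    exact ENNReal.toReal_le_of_le_ofReal (by positivity) (h x hx1)

end IntegratedTail

/-- Either the logarithm is at least `1` and `X²` is dominated by the given function, or `X < e - 1
< 2` and `X² ≤ 4`. -/
theorem memLp_two_of_sq_mul_log {Ω : Type*} [MeasurableSpace Ω] {μ : Measure Ω}
    [IsProbabilityMeasure μ] {X : Ω → ℝ} (hXm : Measurable X) (hX0 : ∀ᵐ ω ∂μ, 0 ≤ X ω)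
    (hlog : Integrable (fun ω => X ω ^ 2 * Real.log (1 + X ω)) μ) : MemLp X 2 μ := by
  rw [memLp_two_iff_integrable_sq hXm.aestronglyMeasurable]
  refine (hlog.add (integrable_const 4)).mono' (hXm.pow_const 2).aestronglyMeasurable ?_
  filter_upwards [hX0] with ω h
  rw [Real.norm_eq_abs, abs_of_nonneg (sq_nonneg _)]
  simp only [Pi.add_apply]
  have hl0 : 0 ≤ Real.log (1 + X ω) := Real.log_nonneg (by linarith)
  rcases le_or_gt 1 (Real.log (1 + X ω)) with h1 | h1
  · nlinarith [sq_nonneg (X ω)]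
  · have h2 : 1 + X ω < Real.exp 1 := (Real.log_lt_iff_lt_exp (by linarith)).1 h1
    have h3 := Real.exp_one_lt_d9
    have := mul_nonneg (sq_nonneg (X ω)) hl0
    nlinarith

theorem mainTheorem5 {Ω : Type*} [MeasurableSpace Ω] (μ : Measure Ω) [IsProbabilityMeasure μ]
    (τ ξ : ℕ → Ω → ℝ)
    -- the inter-claim times and the claim sizes: two independent i.i.d. sequences
    (hτ_meas : ∀ n, Measurable (τ n)) (hξ_meas : ∀ n, Measurable (ξ n))
    (hτ_nonneg : ∀ n, ∀ᵐ ω ∂μ, 0 ≤ τ n ω) (hξ_nonneg : ∀ n, ∀ᵐ ω ∂μ, 0 ≤ ξ n ω)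
    (hindep : iIndepFun (Sum.elim τ ξ) μ)
    (hτ_ident : ∀ n, IdentDistrib (τ n) (τ 0) μ μ)
    (hξ_ident : ∀ n, IdentDistrib (ξ n) (ξ 0) μ μ)
    (hτ_mean : 0 < ∫ ω, τ 0 ω ∂μ)
    -- the premium rate
    (v : ℝ → ℝ) (hv_meas : Measurable v) (hv_nonneg : ∀ y, 0 ≤ v y)
    (hv_bdd : ∃ M : ℝ, ∀ y, v y ≤ M)
    -- the risk reserve process started from `x`, for every `x > 0`
    (R : ℝ → ℝ → Ω → ℝ) (hR : ∀ x : ℝ, 0 < x → IsRiskReserve μ v τ ξ x (R x))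
    -- the rate of convergence to the critical rate
    (θ : ℝ) (hv_rate : ApproachesAtRate v (criticalRate μ (τ 0) (ξ 0)) θ)
    (hθ : limitVariance μ (τ 0) (ξ 0) / (2 * ∫ ω, τ 0 ω ∂μ) < θ)
    (hτ_log : Integrable (fun ω => τ 0 ω ^ 2 * Real.log (1 + τ 0 ω)) μ)
    -- the regularly varying tail of the claim size
    (β : ℝ) (hβ : 0 < β) (hβρ : β < ruinExponent μ (τ 0) (ξ 0) θ)
    (L : ℝ → ℝ) (hL : SlowlyVarying L)
    (htail : ∀ x : ℝ, 0 < x → μ.real {ω | x < ξ 0 ω} = x ^ (-2 - β) * L x) :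
    IntegrableOn (fun y : ℝ => y * μ.real {ω | y < ξ 0 ω}) (Set.Ioi 0) ∧
    (∃ C₁ C₂ : ℝ, 0 < C₁ ∧ 0 < C₂ ∧ ∀ x : ℝ, 0 < x →
      C₁ * (∫ y in Set.Ioi x, y * μ.real {ω | y < ξ 0 ω}) ≤ ruinProb μ (R x) ∧
      ruinProb μ (R x) ≤ C₂ * ∫ y in Set.Ioi x, y * μ.real {ω | y < ξ 0 ω}) ∧
    (∀ x₀ : ℝ, 0 < x₀ → ∃ C₁ C₂ : ℝ, 0 < C₁ ∧ 0 < C₂ ∧ ∀ x : ℝ, x₀ ≤ x →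
      C₁ * (x ^ 2 * μ.real {ω | x < ξ 0 ω}) ≤ ruinProb μ (R x) ∧
      ruinProb μ (R x) ≤ C₂ * (x ^ 2 * μ.real {ω | x < ξ 0 ω})) := by

  obtain ⟨M, hM⟩ := hv_bdd
  have hν : IsProbabilityMeasure (μ.map (ξ 0)) :=
    Measure.isProbabilityMeasure_map (hξ_meas 0).aemeasurable
  have htail_eq : ∀ y, μ.real {ω | y < ξ 0 ω} = (μ.map (ξ 0)).real (Set.Ioi y) := fun y =>
    (measureReal_map_Ioi (hξ_meas 0) y).symm
  simp only [htail_eq] at htail ⊢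
  set F : ℝ → ℝ := fun y => (μ.map (ξ 0)).real (Set.Ioi y) with hFdef
  have hν0 : (μ.map (ξ 0)) (Set.Iio 0) = 0 := by
    rw [Measure.map_apply (hξ_meas 0) measurableSet_Iio]
    refine measure_mono_null ?_ (ae_iff.1 (hξ_nonneg 0))
    exact fun ω hω => not_le.2 hω
  have hξ2 : MemLp (ξ 0) 2 μ := by
    rw [memLp_two_iff_integrable_sq (hξ_meas 0).aestronglyMeasurable]
    refine ⟨((hξ_meas 0).pow_const 2).aestronglyMeasurable, ?_⟩
    rw [hasFiniteIntegral_iff_ofReal (Eventually.of_forall fun ω => sq_nonneg _)]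
    have := lintegral_sq_lt_top hν0 hβ hL htail
    rwa [lintegral_map (by fun_prop) (hξ_meas 0)] at this
  have h : ClaimInputs μ τ ξ := ⟨hτ_meas, hξ_meas, hτ_nonneg, hξ_nonneg, hindep, hτ_ident,
    hξ_ident, hτ_mean, memLp_two_of_sq_mul_log (hτ_meas 0) (hτ_nonneg 0) hτ_log, hξ2⟩
  have hθ0 : 0 ≤ θ := by
    refine le_trans (div_nonneg ?_ (by linarith)) hθ.le
    rw [← h.walk_moments.2]
    exact integral_nonneg fun ω => sq_nonneg _
  have hFpos : ∀ x, 0 < F x := tail_pos hL htail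
  have hFanti : Antitone F := tail_antitone _
  obtain ⟨X₁, C, hX₁, hC, hupper⟩ := h.ruinProb_le hv_nonneg hR hv_rate hβ hβρ hL htail
  obtain ⟨X₂, c, hX₂, hc, hlower⟩ := h.ruinProb_ge hv_nonneg hR hθ0 hv_rate hβ hL htail
  obtain ⟨X₃, a, A, hX₃, ha, hA, hG⟩ := integral_mul_tail_bounds hβ hL htail
  set X := max X₁ (max X₂ X₃) with hX
  have hXX₁ : X₁ ≤ X := le_max_left _ _
  have hXX₂ : X₂ ≤ X := (le_max_left _ _).trans (le_max_right _ _)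
  have hXX₃ : X₃ ≤ X := (le_max_right _ _).trans (le_max_right _ _)
  have hX0 : 0 < X := hX₁.trans_le hXX₁
  obtain ⟨c', hc', hsmall⟩ := h.ruinProb_ge_of_le hv_nonneg hM hR hFpos X
  have hone : ∀ x, ruinProb μ (R x) ≤ 1 := fun x => measureReal_le_one
  refine ⟨integrableOn_mul_tail hβ hL htail, ?_, fun x₀ hx₀ => ?_⟩
  · have hGX : 0 < ∫ y in Set.Ioi X, y * F y :=
      lt_of_lt_of_le (mul_pos ha (mul_pos (by positivity) (hFpos X))) (hG X hXX₃).1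
    have hGanti : ∀ x y, 0 ≤ x → x ≤ y → ∫ s in Set.Ioi y, s * F s ≤ ∫ s in Set.Ioi x, s * F s :=
      fun x y => integral_mul_tail_antitone hβ hL htail
    refine exists_two_sided_bound (S := Set.Ioi 0) (X := X) (c := c / A) (C := C / a)
      (u := ∫ y in Set.Ioi 0, y * F y)
      (div_pos hc hA) (div_pos hC ha) hc' hGX (fun x hx => ?_) (fun x hx hXx => ?_)
      (fun x hx hxX => ?_)
    · exact setIntegral_nonneg measurableSet_Ioi fun y hy =>
        mul_nonneg (le_of_lt (lt_trans hx hy)) (hFpos y).le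
    · obtain ⟨h1, h2⟩ := hG x (hXX₃.trans hXx)
      constructor
      · refine le_trans ?_ (hlower x (hXX₂.trans hXx))
        rw [div_mul_eq_mul_div, div_le_iff₀ hA]
        calc c * ∫ y in Set.Ioi x, y * F y ≤ c * (A * (x ^ 2 * F x)) := by gcongr
          _ = c * (x ^ 2 * F x) * A := by ring
      · refine (hupper x (hXX₁.trans hXx)).trans ?_
        rw [div_mul_eq_mul_div, le_div_iff₀ ha]
        calc C * (x ^ 2 * F x) * a = C * (a * (x ^ 2 * F x)) := by ring
          _ ≤ C * ∫ y in Set.Ioi x, y * F y := by gcongr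
    · exact ⟨⟨hsmall x hx hxX, hone x⟩, hGanti x X (le_of_lt hx) hxX, hGanti 0 x le_rfl (le_of_lt hx)⟩
  -- Here `x₀ > 0` is essential: `x² F(x)` tends to `0` as `x` decreases to `0`, while the ruin
  -- probability stays bounded below.
  · refine exists_two_sided_bound (S := Set.Ici x₀) (X := X) hc hC hc'
      (show 0 < x₀ ^ 2 * F X from mul_pos (by positivity) (hFpos X)) (u := X ^ 2 * F x₀)
      (fun x _ => mul_nonneg (sq_nonneg x) (hFpos x).le)
      (fun x _ hXx => ⟨hlower x (hXX₂.trans hXx), hupper x (hXX₁.trans hXx)⟩)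
      (fun x hx hxX => ?_)
    have hx : x₀ ≤ x := hx
    have hx0 : 0 < x := hx₀.trans_le hx
    refine ⟨⟨hsmall x hx0 hxX, hone x⟩, ?_, ?_⟩
    · exact mul_le_mul (by gcongr) (hFanti hxX) (hFpos X).le (sq_nonneg x)
    · exact mul_le_mul (by gcongr) (hFanti hx) (hFpos x).le (sq_nonneg X)
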